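/- Let $\mathbb{Z}\wr\mathbb{Z}$ be the group of all pairs $(y,b)$, where $y\colon\mathbb{Z}\to\mathbb{Z}$ is a function with finite support and $b\in\mathbb{Z}$, with multiplication $(y,h)(z,k)=(y^{k}+z,\;h+k)$, where $y^{k}(x)=y(x-k)$ for all $x\in\mathbb{Z}$. For a finite subset $\mathcal{G}$ of $\mathbb{Z}\wr\mathbb{Z}$ let $\langle\mathcal{G}\rangle$ be the semigroup generated by $\mathcal{G}$, that is, the set of all products of one or more elements of $\mathcal{G}$. The following two problems are decidable. Their input is a finite set $\mathcal{G}=\{(y_1,b_1),\dots,(y_n,b_n)\}\subseteq\mathbb{Z}\wr\mathbb{Z}$ with $b_i\in\{1,-1\}$ for all $i$, where each $y_i$ is given as a finite list of pairs (position, value) and stands for the sum of the corresponding one-point functions. 1. (Group Problem) Is the semigroup $\langle\mathcal{G}\rangle$ a group? 2. (Identity Problem) Does $\langle\mathcal{G}\rangle$ contain the neutral element of $\mathbb{Z}\wr\mathbb{Z}$? -/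

import Mathlib

/-- The (restricted) wreath product `ℤ ≀ ℤ`: the pairs `(y, b)` where `y : ℤ → ℤ` has finite
support and `b : ℤ`. -/
@[ext]
structure ZWrZ where
  /-- the finitely supported function `y : ℤ → ℤ` -/
  fst : ℤ →₀ ℤ
  /-- the integer `b` -/
  snd : ℤ

namespace ZWrZ

/-- The action of `k : ℤ` on finitely supported functions, `y ↦ y^k` with `y^k (b) = y (b - k)`. -/
noncomputable def act (k : ℤ) (y : ℤ →₀ ℤ) : ℤ →₀ ℤ :=
  y.equivMapDomain (Equiv.addRight k)

@[simp]
theorem act_apply (k : ℤ) (y : ℤ →₀ ℤ) (b : ℤ) : act k y b = y (b - k) := by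
  simp [act, Finsupp.equivMapDomain_apply, sub_eq_add_neg]

/-- The multiplication `(y, h) (z, k) = (y^k z, h k)`; both factors `ℤ` are written additively. -/
noncomputable instance : Mul ZWrZ where
  mul a b := ⟨act b.snd a.fst + b.fst, a.snd + b.snd⟩

instance : One ZWrZ where
  one := ⟨0, 0⟩

noncomputable instance : Inv ZWrZ where
  inv a := ⟨-act (-a.snd) a.fst, -a.snd⟩

@[simp]
theorem mul_fst (a b : ZWrZ) : (a * b).fst = act b.snd a.fst + b.fst := rfl

@[simp]
theorem mul_snd (a b : ZWrZ) : (a * b).snd = a.snd + b.snd := rfl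

@[simp]
theorem one_fst : (1 : ZWrZ).fst = 0 := rfl

@[simp]
theorem one_snd : (1 : ZWrZ).snd = 0 := rfl

@[simp]
theorem inv_fst (a : ZWrZ) : (a⁻¹).fst = -act (-a.snd) a.fst := rfl

@[simp]
theorem inv_snd (a : ZWrZ) : (a⁻¹).snd = -a.snd := rfl

noncomputable instance : Group ZWrZ where
  mul_assoc a b c := by
    ext x
    · simp [add_assoc, sub_sub, add_comm]
    · simp [add_assoc]
  one_mul a := by
    ext x <;> simp
  mul_one a := by
    ext x <;> simp
  inv_mul_cancel a := by
    ext x <;> simp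

/-- The element of `ℤ ≀ ℤ` that is written down as a pair `(l, b)`, where `l` is a finite list of
pairs (position, value): it is `(y, b)` for the function `y` that is the sum over the pairs
`(k, c)` of `l` of the functions with value `c` at `k` and `0` elsewhere. Every element of `ℤ ≀ ℤ`
can be written down in this way. -/
noncomputable def ofCode (c : List (ℤ × ℤ) × ℤ) : ZWrZ :=
  ⟨(c.1.map fun p => Finsupp.single p.1 p.2).sum, c.2⟩

theorem ofCode_surjective : Function.Surjective ofCode := by
  rintro ⟨y, b⟩
  refine ⟨(y.support.toList.map fun k => (k, y k), b), ?_⟩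
  simp only [ofCode, List.map_map]
  congr 1
  change (y.support.toList.map fun k => Finsupp.single k (y k)).sum = y
  rw [Finset.sum_map_toList]
  exact y.sum_single

/-- The finite set of elements of `ℤ ≀ ℤ` that is written down as a list of codes. -/
def generators (L : List (List (ℤ × ℤ) × ℤ)) : Set ZWrZ :=
  {g | ∃ c ∈ L, ofCode c = g}

end ZWrZ

/-- A semigroup `S` is a group: it has a neutral element `e`, and every element of `S` has an
inverse in `S` with respect to `e`. (In particular `S` is not empty.) -/
def SemigroupIsGroup (S : Type*) [Semigroup S] : Prop :=
  ∃ e : S, (∀ x : S, e * x = x ∧ x * e = x) ∧ ∀ x : S, ∃ y : S, x * y = e ∧ y * x = e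

/-- The decision problem "given an input `a` that satisfies `D`, does `P a` hold?" is decidable:
some computable (total recursive) function answers it correctly on all inputs that satisfy `D`. -/
def DecidableProblem {α : Type*} [Primcodable α] (D P : α → Prop) : Prop :=
  ∃ f : α → Bool, Computable f ∧ ∀ a, D a → (f a = true ↔ P a)

/-! A word over the generators is a walk on ℤ with steps ±1. Its first component is the sum of the
functions used, each shifted by the height of the letters to its right. With functions read as
Laurent polynomials, the semigroup is a group iff some neutral word uses every generator
(`semigroupIsGroup_iff`), and it contains the neutral element iff some sublist of the generators
admits such a word (`one_mem_closure_iff`).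

Each pair of an up step (y, 1) and a down step (z, -1) gives a loop y + Xz. A neutral word crosses
every edge of ℤ equally often in both directions. Multiplying the usage counts of up and down steps
therefore turns a full neutral word into a linear relation between the loops whose coefficients are
positive on (0, ∞). Conversely, a relation with nonzero natural coefficients can be made gapless in
degree (`exists_gapless_syzygy`) and then realised by nesting loops level by level
(`isLoop_of_gapless`). Thus, when loops exist, the question is whether they have a positive syzygy.

If they have none, divide them by their gcd. By `exists_nat_syzygy` the quotients cannot take both
signs at every positive real, so at some r > 0 they all have one weak sign and do not all vanish.
This r can be chosen algebraic, and then finite data witness it: a polynomial g with a sign change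
on a rational interval, with each quotient either a multiple of g or visibly positive on the
interval. Such data exclude a positive syzygy (`Obstructs.sum_mul_ne_zero`) and can be checked by
integer arithmetic. Both answers thus have primitive recursive certificates, and Post's theorem
decides the problem (`DecidableProblem.of_primrec`). -/

section

/-! ### Positive polynomial syzygies on [0, 1] -/

open Polynomial

theorem exists_rat_polynomial_near_polynomial (p : ℝ[X]) :
    ∀ ε > 0, ∃ q : ℚ[X], ∀ t ∈ Set.Icc (0 : ℝ) 1, |aeval t q - p.eval t| < ε := by
  induction p using Polynomial.induction_on' with
  | add p q hp hq =>
    intro ε hε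
    obtain ⟨p', hp'⟩ := hp (ε / 2) (by positivity)
    obtain ⟨q', hq'⟩ := hq (ε / 2) (by positivity)
    refine ⟨p' + q', fun t ht => ?_⟩
    have h1 := abs_lt.1 (hp' t ht)
    have h2 := abs_lt.1 (hq' t ht)
    rw [map_add, eval_add, abs_lt]
    constructor <;> linarith
  | monomial n a =>
    intro ε hε
    obtain ⟨r, hr1, hr2⟩ := exists_rat_btwn (show a - ε < a by linarith)
    refine ⟨monomial n r, fun t ht => ?_⟩
    rw [aeval_monomial, eval_monomial, ← sub_mul, abs_mul, abs_of_nonneg (pow_nonneg ht.1 n)]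
    have h1 : |(algebraMap ℚ ℝ) r - a| < ε := by
      rw [abs_lt]; constructor <;> simp <;> linarith
    calc _ ≤ |(algebraMap ℚ ℝ) r - a| * 1 :=
          mul_le_mul_of_nonneg_left (pow_le_one₀ ht.1 ht.2) (abs_nonneg _)
      _ < ε := by simpa using h1

theorem exists_rat_polynomial_near {f : ℝ → ℝ} (hf : ContinuousOn f (Set.Icc 0 1)) {ε : ℝ}
    (hε : 0 < ε) : ∃ q : ℚ[X], ∀ t ∈ Set.Icc (0 : ℝ) 1, |aeval t q - f t| < ε := by
  obtain ⟨p, hp⟩ := exists_polynomial_near_of_continuousOn 0 1 f hf (ε / 2) (by positivity)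
  obtain ⟨q, hq⟩ := exists_rat_polynomial_near_polynomial p (ε / 2) (by positivity)
  refine ⟨q, fun t ht => ?_⟩
  have h1 := abs_lt.1 (hp t ht)
  have h2 := abs_lt.1 (hq t ht)
  rw [abs_lt]
  constructor <;> linarith

/-- Start with all weights equal to 1 and let σ be the resulting sum. Where σ < 0, raise the weights
of the positive members in proportion to their size; where σ > 0, do so for the negative members.
`P` and `N` normalise the correction so that it cancels σ exactly. -/
theorem exists_continuousOn_one_le_sum_mul_eq_zero {K : Type*} [Fintype K] {s : Set ℝ}
    {w : K → ℝ → ℝ} (hw : ∀ k, ContinuousOn (w k) s) (hpos : ∀ t ∈ s, ∃ k, 0 < w k t)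
    (hneg : ∀ t ∈ s, ∃ k, w k t < 0) :
    ∃ h : K → ℝ → ℝ, (∀ k, ContinuousOn (h k) s) ∧ (∀ k, ∀ t ∈ s, 1 ≤ h k t) ∧
      ∀ t ∈ s, ∑ k, h k t * w k t = 0 := by
  set σ : ℝ → ℝ := fun t => ∑ k, w k t with hσ
  set P : ℝ → ℝ := fun t => ∑ k, max (w k t) 0 ^ 2 with hP
  set N : ℝ → ℝ := fun t => ∑ k, max (-w k t) 0 ^ 2 with hN
  have hPpos : ∀ t ∈ s, 0 < P t := fun t ht => by
    obtain ⟨k, hk⟩ := hpos t ht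
    exact Finset.sum_pos' (fun _ _ => by positivity)
      ⟨k, Finset.mem_univ _, pow_pos (lt_max_of_lt_left hk) 2⟩
  have hNpos : ∀ t ∈ s, 0 < N t := fun t ht => by
    obtain ⟨k, hk⟩ := hneg t ht
    exact Finset.sum_pos' (fun _ _ => by positivity)
      ⟨k, Finset.mem_univ _, pow_pos (lt_max_of_lt_left (by linarith)) 2⟩
  have cσ : ContinuousOn σ s := by fun_prop
  have cP : ContinuousOn P s := by fun_prop
  have cN : ContinuousOn N s := by fun_prop
  refine ⟨fun k t => 1 + max (-σ t) 0 / P t * max (w k t) 0 + max (σ t) 0 / N t * max (-w k t) 0,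
    fun k => ?_, fun k t ht => ?_, fun t ht => ?_⟩
  · have h1 : ContinuousOn (fun t => max (-σ t) 0 / P t) s :=
      ContinuousOn.div (by fun_prop) cP fun t ht => (hPpos t ht).ne'
    have h2 : ContinuousOn (fun t => max (σ t) 0 / N t) s :=
      ContinuousOn.div (by fun_prop) cN fun t ht => (hNpos t ht).ne'
    fun_prop
  · have := hPpos t ht
    have := hNpos t ht
    have h1 : 0 ≤ max (-σ t) 0 / P t * max (w k t) 0 := by positivity
    have h2 : 0 ≤ max (σ t) 0 / N t * max (-w k t) 0 := by positivity
    simp only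
    linarith
  · have e1 : ∀ x : ℝ, max x 0 * x = max x 0 ^ 2 := fun x => by
      rcases le_total x 0 with h | h <;> simp [h, sq]
    have e2 : ∀ x : ℝ, max (-x) 0 * x = -max (-x) 0 ^ 2 := fun x => by
      rcases le_total x 0 with h | h <;> simp [h, sq]
    have e3 : ∀ x : ℝ, x + max (-x) 0 - max x 0 = 0 := fun x => by
      rcases le_total x 0 with h | h <;> simp [h]
    have : ∀ k, (1 + max (-σ t) 0 / P t * max (w k t) 0 + max (σ t) 0 / N t * max (-w k t) 0) *
        w k t = w k t + max (-σ t) 0 / P t * max (w k t) 0 ^ 2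
          - max (σ t) 0 / N t * max (-w k t) 0 ^ 2 := fun k => by
      rw [← e1, ← neg_neg (max (-w k t) 0 ^ 2), ← e2]; ring
    simp only [this, Finset.sum_add_distrib, Finset.sum_sub_distrib, ← Finset.mul_sum]
    change σ t + max (-σ t) 0 / P t * P t - max (σ t) 0 / N t * N t = 0
    rw [div_mul_cancel₀ _ (hPpos t ht).ne', div_mul_cancel₀ _ (hNpos t ht).ne', e3]

/-- Approximating a continuous syzygy directly would destroy the relation. Since the `w k` have no
common zero, the syzygy is a combination of Koszul syzygies with continuous coefficients h_k w_l /
Q. Only these coefficients are approximated, so antisymmetry keeps the relation exact. -/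
theorem exists_rat_polynomial_pos_sum_mul_eq_zero {K : Type*} [Fintype K] {w : K → ℚ[X]}
    (hpos : ∀ t ∈ Set.Icc (0 : ℝ) 1, ∃ k, 0 < aeval t (w k))
    (hneg : ∀ t ∈ Set.Icc (0 : ℝ) 1, ∃ k, aeval t (w k) < 0) :
    ∃ h : K → ℚ[X], (∀ k, ∀ t ∈ Set.Icc (0 : ℝ) 1, 0 < aeval t (h k)) ∧
      ∑ k, h k * w k = 0 := by
  have hc : ∀ k, ContinuousOn (fun t : ℝ => aeval t (w k)) (Set.Icc (0 : ℝ) 1) :=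
    fun k => (w k).continuous_aeval.continuousOn
  obtain ⟨h, ch, h1, h0⟩ := exists_continuousOn_one_le_sum_mul_eq_zero hc hpos hneg
  set Q : ℝ → ℝ := fun t => ∑ k, aeval t (w k) ^ 2 with hQ
  have hQpos : ∀ t ∈ Set.Icc (0 : ℝ) 1, 0 < Q t := fun t ht => by
    obtain ⟨k, hk⟩ := hpos t ht
    exact Finset.sum_pos' (fun _ _ => by positivity) ⟨k, Finset.mem_univ _, by positivity⟩
  have cQ : ContinuousOn Q (Set.Icc 0 1) := by fun_prop
  have hbd : ∀ k, ∃ B, ∀ t ∈ Set.Icc (0 : ℝ) 1, |aeval t (w k)| ≤ B := fun k => by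
    obtain ⟨B, hB⟩ := isCompact_Icc.exists_bound_of_continuousOn (hc k)
    exact ⟨B, hB⟩
  choose B hB using hbd
  -- With coefficient error 1/(4b), each antisymmetrised coefficient errs by at most 1/(2b), so the
  -- total error stays below 1, the lower bound of the continuous solution.
  set b : ℝ := 1 + ∑ k, |B k| with hb
  have hbpos : 0 < b := by positivity
  have hBb : ∀ k, ∀ t ∈ Set.Icc (0 : ℝ) 1, |aeval t (w k)| ≤ |B k| :=
    fun k t ht => (hB k t ht).trans (le_abs_self _)
  have hS : ∀ k l, ∃ p : ℚ[X], ∀ t ∈ Set.Icc (0 : ℝ) 1,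
      |aeval t p - h k t * aeval t (w l) / Q t| < 1 / (4 * b) := fun k l =>
    exists_rat_polynomial_near (ContinuousOn.div (by fun_prop) cQ fun t ht => (hQpos t ht).ne')
      (by positivity)
  choose p hp using hS
  refine ⟨fun k => ∑ l, (p k l - p l k) * w l, fun k t ht => ?_, ?_⟩
  · have e : h k t = ∑ l, (h k t * aeval t (w l) / Q t - h l t * aeval t (w k) / Q t) *
        aeval t (w l) := by
      have : ∀ l, (h k t * aeval t (w l) / Q t - h l t * aeval t (w k) / Q t) * aeval t (w l)
          = h k t / Q t * aeval t (w l) ^ 2 - aeval t (w k) / Q t * (h l t * aeval t (w l)) :=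
        fun l => by ring
      simp only [this, Finset.sum_sub_distrib, ← Finset.mul_sum, h0 t ht]
      change _ = h k t / Q t * Q t - _
      rw [div_mul_cancel₀ _ (hQpos t ht).ne']; simp
    have hd : |aeval t (∑ l, (p k l - p l k) * w l) - h k t| ≤ ∑ l, 1 / (2 * b) * |B l| := by
      rw [e, map_sum, ← Finset.sum_sub_distrib]
      refine (Finset.abs_sum_le_sum_abs _ _).trans (Finset.sum_le_sum fun l _ => ?_)
      rw [map_mul, map_sub, ← sub_mul, abs_mul]
      refine mul_le_mul ?_ (hBb l t ht) (abs_nonneg _) (by positivity)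
      have a1 := abs_lt.1 (hp k l t ht)
      have a2 := abs_lt.1 (hp l k t ht)
      have : 1 / (2 * b) = 1 / (4 * b) + 1 / (4 * b) := by field_simp; norm_num
      rw [abs_le]
      constructor <;> linarith
    rw [← Finset.mul_sum] at hd
    have : 1 / (2 * b) * ∑ l, |B l| < 1 := by
      rw [div_mul_eq_mul_div, div_lt_one (by positivity)]; linarith
    have := (abs_le.1 hd).1
    have := h1 k t ht
    linarith
  · have : ∑ k, (∑ l, (p k l - p l k) * w l) * w k =
        ∑ k, ∑ l, p k l * w l * w k - ∑ k, ∑ l, p l k * w l * w k := by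
      rw [← Finset.sum_sub_distrib]
      refine Finset.sum_congr rfl fun k _ => ?_
      rw [Finset.sum_mul, ← Finset.sum_sub_distrib]
      exact Finset.sum_congr rfl fun l _ => by ring
    rw [this, Finset.sum_comm (f := fun k l => p l k * w l * w k), sub_eq_zero]
    exact Finset.sum_congr rfl fun k _ => Finset.sum_congr rfl fun l _ => by ring

/-! ### From [0, 1] to the positive half-line: nonnegative coefficients -/

theorem abs_sub_div_sub_div_le {i j N : ℕ} (hi : i ≤ N) (hj : j < N) :
    |((i - j : ℕ) : ℝ) / ((N - j : ℕ) : ℝ) - (i : ℝ) / N| ≤ j / ((N - j : ℕ) : ℝ) := by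
  have hN : (0 : ℝ) < N := by exact_mod_cast (by omega : 0 < N)
  have hNj : (0 : ℝ) < ((N - j : ℕ) : ℝ) := by exact_mod_cast (by omega : 0 < N - j)
  rcases le_total j i with h | h
  · have hi' : (i : ℝ) ≤ N := by exact_mod_cast hi
    rw [Nat.cast_sub h, Nat.cast_sub hj.le] at *
    have : ((i : ℝ) - j) / (N - j) - i / N = -(j / (N - j) * ((N - i) / N)) := by
      field_simp; ring
    rw [this, abs_neg, abs_of_nonneg (mul_nonneg (by positivity)
      (div_nonneg (by linarith) hN.le))]
    refine mul_le_of_le_one_right (by positivity) ?_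
    rw [div_le_one hN]
    have : (0 : ℝ) ≤ i := by positivity
    linarith
  · rw [Nat.sub_eq_zero_of_le h, Nat.cast_zero, zero_div, zero_sub, abs_neg,
      abs_of_nonneg (by positivity)]
    exact div_le_div₀ (by positivity) (by exact_mod_cast h) hNj (by exact_mod_cast Nat.sub_le N j)

theorem exists_forall_abs_descFactorial_div_sub_pow_le (j : ℕ) :
    ∀ ε > (0 : ℝ), ∃ N₀ : ℕ, ∀ N ≥ N₀, ∀ i ≤ N,
      |(i.descFactorial j : ℝ) / N.descFactorial j - ((i : ℝ) / N) ^ j| ≤ ε := by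
  induction j with
  | zero => intro ε hε; exact ⟨0, fun N _ i _ => by simpa using hε.le⟩
  | succ j ih =>
    intro ε hε
    obtain ⟨N₁, h1⟩ := ih (ε / 2) (by positivity)
    obtain ⟨M, hM⟩ := exists_nat_gt (2 * j / ε)
    -- For such N, N - j ≥ M > 2j/ε, so the new factor (i - j)/(N - j) is within ε/2 of i/N.
    refine ⟨max N₁ (j + M + 1), fun N hN i hi => ?_⟩
    have hN1 : N₁ ≤ N := (le_max_left _ _).trans hN
    have hN2 : j + M + 1 ≤ N := (le_max_right _ _).trans hN
    have hjN : j < N := by omega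
    have hNpos : (0 : ℝ) < N := by exact_mod_cast (by omega : 0 < N)
    have hNj : (0 : ℝ) < ((N - j : ℕ) : ℝ) := by exact_mod_cast (by omega : 0 < N - j)
    rw [Nat.descFactorial_succ, Nat.descFactorial_succ, Nat.cast_mul, Nat.cast_mul,
      mul_div_mul_comm, pow_succ']
    set x := ((i - j : ℕ) : ℝ) / ((N - j : ℕ) : ℝ)
    set y := (i : ℝ) / N
    set A := (i.descFactorial j : ℝ) / N.descFactorial j
    have hx0 : 0 ≤ x := by positivity
    have hx1 : x ≤ 1 := by
      rw [div_le_one hNj]; exact_mod_cast (by omega : i - j ≤ N - j)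
    have hy0 : 0 ≤ y := by positivity
    have hy1 : y ≤ 1 := by rw [div_le_one hNpos]; exact_mod_cast hi
    have hxy : |x - y| ≤ ε / 2 := (abs_sub_div_sub_div_le hi hjN).trans (by
      rw [div_le_iff₀ hNj]
      have : (M : ℝ) ≤ ((N - j : ℕ) : ℝ) := by exact_mod_cast (by omega : M ≤ N - j)
      rw [div_lt_iff₀ hε] at hM
      nlinarith)
    calc |x * A - y * y ^ j| = |x * (A - y ^ j) + (x - y) * y ^ j| := by ring_nf
      _ ≤ |x * (A - y ^ j)| + |(x - y) * y ^ j| := abs_add_le _ _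
      _ = x * |A - y ^ j| + |x - y| * y ^ j := by
        rw [abs_mul, abs_mul, abs_of_nonneg hx0, abs_of_nonneg (pow_nonneg hy0 j)]
      _ ≤ 1 * (ε / 2) + ε / 2 * 1 :=
        add_le_add (mul_le_mul hx1 (h1 N hN1 i hi) (abs_nonneg _) zero_le_one)
          (mul_le_mul hxy (pow_le_one₀ hy0 hy1) (pow_nonneg hy0 j) (by positivity))
      _ = ε := by ring

/-- This is Bernstein's argument. The i-th coefficient of Σ h_j X^j (1+X)^(N-j) is C(N, i) times Σ
h_j (i)_j/(N)_j, with falling factorials. For large N the latter sum is uniformly close to h(i/N),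
which is bounded below by the minimum m > 0. -/
theorem exists_coeff_nonneg_of_pos_on_unitInterval {h : ℚ[X]}
    (hpos : ∀ t ∈ Set.Icc (0 : ℝ) 1, 0 < aeval t h) :
    ∃ N₀ : ℕ, ∀ N ≥ N₀, ∃ H : ℚ[X], (∀ i, 0 ≤ H.coeff i) ∧
      ∀ x : ℝ, 0 ≤ x → aeval x H = (1 + x) ^ N * aeval (x / (1 + x)) h := by
  obtain ⟨t₀, ht₀, hmin⟩ := isCompact_Icc.exists_isMinOn (Set.nonempty_Icc.2 zero_le_one)
    (h.continuous_aeval (A := ℝ)).continuousOn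
  set m := aeval t₀ h
  have hm : 0 < m := hpos t₀ ht₀
  set n := h.natDegree
  set s : ℝ := ∑ j ∈ Finset.range (n + 1), |(h.coeff j : ℝ)|
  have hs : 0 ≤ s := Finset.sum_nonneg fun _ _ => abs_nonneg _
  -- Weighted by the |h_j|, these errors add up to at most s·m/(1 + s) ≤ m; the 1 avoids a possible
  -- division by zero.
  have hN := fun j => exists_forall_abs_descFactorial_div_sub_pow_le j (m / (1 + s)) (by positivity)
  choose N₁ hN₁ using hN
  refine ⟨(∑ j ∈ Finset.range (n + 1), N₁ j) + n, fun N hN => ?_⟩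
  have hnN : n ≤ N := by omega
  have hNj : ∀ j ∈ Finset.range (n + 1), N₁ j ≤ N := fun j hj =>
    (Finset.single_le_sum (fun _ _ => Nat.zero_le _) hj).trans (by omega)
  refine ⟨∑ j ∈ Finset.range (n + 1), C (h.coeff j) * (X ^ j * (1 + X) ^ (N - j)),
    fun i => ?_, fun x hx => ?_⟩
  · simp only [finsetSum_coeff, coeff_C_mul, coeff_X_pow_mul', coeff_one_add_X_pow]
    by_cases hi : i ≤ N
    · have key : (∑ j ∈ Finset.range (n + 1), (h.coeff j : ℝ) *
          (if j ≤ i then ((N - j).choose (i - j) : ℝ) else 0)) =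
          N.choose i * ∑ j ∈ Finset.range (n + 1), (h.coeff j : ℝ) *
            ((i.descFactorial j : ℝ) / N.descFactorial j) := by
        rw [Finset.mul_sum]
        refine Finset.sum_congr rfl fun j hj => ?_
        have hjN : j ≤ N := (Finset.mem_range_succ_iff.1 hj).trans hnN
        have hd : (N.descFactorial j : ℝ) ≠ 0 := by
          exact_mod_cast (Nat.descFactorial_pos.2 hjN).ne'
        split_ifs with hji
        · have : (N - j).choose (i - j) * N.descFactorial j = N.choose i * i.descFactorial j := by
            rw [Nat.descFactorial_eq_factorial_mul_choose,
              Nat.descFactorial_eq_factorial_mul_choose,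
              mul_left_comm, mul_left_comm (N.choose i), Nat.choose_mul hji, mul_comm (N.choose j)]
          have : ((N - j).choose (i - j) : ℝ) * N.descFactorial j
            = N.choose i * i.descFactorial j := by exact_mod_cast this
          field_simp
          linear_combination (h.coeff j : ℝ) * this
        · rw [Nat.descFactorial_eq_zero_iff_lt.2 (by omega)]; simp
      have hy : (i : ℝ) / N ∈ Set.Icc (0 : ℝ) 1 :=
        ⟨by positivity, div_le_one_of_le₀ (by exact_mod_cast hi) (by positivity)⟩
      have hev : aeval ((i : ℝ) / N) h =
          ∑ j ∈ Finset.range (n + 1), (h.coeff j : ℝ) * ((i : ℝ) / N) ^ j := by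
        rw [aeval_eq_sum_range]; simp [Algebra.smul_def]; rfl
      have hge : m ≤ aeval ((i : ℝ) / N) h := hmin hy
      have hdiff : |(∑ j ∈ Finset.range (n + 1), (h.coeff j : ℝ) *
            ((i.descFactorial j : ℝ) / N.descFactorial j)) - aeval ((i : ℝ) / N) h| ≤
            s * (m / (1 + s)) := by
        rw [hev, ← Finset.sum_sub_distrib, Finset.sum_mul]
        refine (Finset.abs_sum_le_sum_abs _ _).trans (Finset.sum_le_sum fun j hj => ?_)
        rw [← mul_sub, abs_mul]
        exact mul_le_mul_of_nonneg_left (hN₁ j N (hNj j hj) i hi) (abs_nonneg _)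
      have hsm : s * (m / (1 + s)) ≤ m := by
        rw [← mul_div_assoc, div_le_iff₀ (by positivity)]; nlinarith
      have h0 : (0 : ℝ) ≤ N.choose i * ∑ j ∈ Finset.range (n + 1), (h.coeff j : ℝ) *
            ((i.descFactorial j : ℝ) / N.descFactorial j) := by
        have := (abs_le.1 hdiff).1
        exact mul_nonneg (by positivity) (by linarith)
      rw [← key] at h0
      have : (0 : ℝ) ≤ ((∑ j ∈ Finset.range (n + 1), h.coeff j *
          (if j ≤ i then ((N - j).choose (i - j) : ℚ) else 0) : ℚ) : ℝ) := by
        simpa only [Rat.cast_sum, Rat.cast_mul, apply_ite (Rat.cast (K := ℝ)), Rat.cast_natCast,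
          Rat.cast_zero] using h0
      exact_mod_cast this
    · refine Finset.sum_nonneg fun j hj => ?_
      rw [Nat.choose_eq_zero_of_lt (by have := Finset.mem_range_succ_iff.1 hj; omega)]
      simp
  · have hx1 : 1 + x ≠ 0 := by positivity
    rw [aeval_eq_sum_range (p := h), Finset.mul_sum, map_sum]
    refine Finset.sum_congr rfl fun j hj => ?_
    have hjN : j ≤ N := (Finset.mem_range_succ_iff.1 hj).trans hnN
    simp only [map_mul, aeval_C, map_pow, aeval_X, map_add, map_one, Algebra.smul_def]
    rw [div_pow, ← Nat.sub_add_cancel hjN, pow_add, Nat.add_sub_cancel]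
    field_simp

/-- Split off the power of X at 0 and homogenise the rest in x/(1+x) and 1/(1+x). The values of `w`
at 0 and 1 are then the lowest and the leading coefficient of `v`, so a nonzero `w` vanishes at
neither endpoint. -/
theorem exists_unitInterval_model (v : ℚ[X]) :
    ∃ (w : ℚ[X]) (n m : ℕ),
      (∀ x : ℝ, 0 ≤ x → aeval x v = x ^ m * ((1 + x) ^ n * aeval (x / (1 + x)) w)) ∧
      (w = 0 ∨ aeval (0 : ℝ) w ≠ 0 ∧ aeval (1 : ℝ) w ≠ 0) := by
  rcases eq_or_ne v 0 with rfl | hv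
  · exact ⟨0, 0, 0, by simp, Or.inl rfl⟩
  obtain ⟨q, hq, hndvd⟩ := exists_eq_pow_rootMultiplicity_mul_and_not_dvd v hv 0
  rw [C_0, sub_zero] at hq hndvd
  have hq0 : q.coeff 0 ≠ 0 := fun h => hndvd (X_dvd_iff.2 h)
  have hq1 : q ≠ 0 := by rintro rfl; simp at hq0
  set n := q.natDegree
  refine ⟨∑ j ∈ Finset.range (n + 1), C (q.coeff j) * (X ^ j * (1 - X) ^ (n - j)), n,
    rootMultiplicity 0 v,
    fun x hx => ?_, Or.inr ⟨?_, ?_⟩⟩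
  · have hx1 : 1 + x ≠ 0 := by positivity
    nth_rw 1 [hq]
    rw [map_mul, map_pow, aeval_X]
    congr 1
    rw [aeval_eq_sum_range (p := q), map_sum, Finset.mul_sum]
    refine Finset.sum_congr rfl fun j hj => ?_
    have hjn : j ≤ n := Finset.mem_range_succ_iff.1 hj
    have e : 1 - x / (1 + x) = 1 / (1 + x) := by field_simp; ring
    simp only [map_mul, aeval_C, map_pow, aeval_X, map_sub, map_one, Algebra.smul_def, e]
    rw [div_pow, div_pow, ← Nat.sub_add_cancel hjn, pow_add, Nat.add_sub_cancel]
    field_simp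
    rw [one_pow, mul_one]
  · rw [map_sum, Finset.sum_eq_single 0]
    · simpa using hq0
    · intro j _ hj; simp [hj]
    · simp
  · rw [map_sum, Finset.sum_eq_single n]
    · simpa [n] using hq1
    · intro j hj hjn
      have : n - j ≠ 0 := by have := Finset.mem_range_succ_iff.1 hj; omega
      simp [this]
    · simp

/-- If no member were positive at an endpoint, the nonzero ones would be strictly negative there,
hence also nearby inside the interval. -/
theorem exists_pos_on_Icc_of_exists_pos_on_Ioo {K : Type*} [Finite K] {w : K → ℚ[X]}
    (hw : ∀ k, w k = 0 ∨ aeval (0 : ℝ) (w k) ≠ 0 ∧ aeval (1 : ℝ) (w k) ≠ 0)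
    (h : ∀ t ∈ Set.Ioo (0 : ℝ) 1, ∃ k, 0 < aeval t (w k)) :
    ∀ t ∈ Set.Icc (0 : ℝ) 1, ∃ k, 0 < aeval t (w k) := by
  intro t ht
  by_cases ht' : t ∈ Set.Ioo (0 : ℝ) 1
  · exact h t ht'
  have ht01 : t = 0 ∨ t = 1 := by
    by_contra! hne
    exact ht' ⟨lt_of_le_of_ne ht.1 hne.1.symm, lt_of_le_of_ne ht.2 hne.2⟩
  by_contra! hle
  have hev : ∀ k, ∀ᶠ x in nhds t, aeval x (w k) ≤ 0 := fun k => by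
    rcases hw k with h0 | h01
    · simp [h0]
    · have hlt : aeval t (w k) < 0 := lt_of_le_of_ne (hle k) (by
        rcases ht01 with rfl | rfl
        exacts [h01.1, h01.2])
      exact (((w k).continuous_aeval (A := ℝ)).continuousAt.eventually_lt_const hlt).mono
        fun _ hx => hx.le
  have hne : (nhdsWithin t (Set.Ioo (0 : ℝ) 1)).NeBot :=
    mem_closure_iff_nhdsWithin_neBot.1 (by rwa [closure_Ioo zero_ne_one])
  have hev' : ∀ᶠ x in nhdsWithin t (Set.Ioo (0 : ℝ) 1), ∀ k, aeval x (w k) ≤ 0 :=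
    (Filter.eventually_all.2 hev).filter_mono nhdsWithin_le_nhds
  obtain ⟨x, hx1, hx2⟩ := (hev'.and self_mem_nhdsWithin).exists
  obtain ⟨k, hk⟩ := h x hx2
  exact absurd (hx1 k) (not_le.2 hk)

theorem exists_nat_smul_eq_map_int {K : Type*} [Finite K] (R : K → ℚ[X]) :
    ∃ c : ℕ, 0 < c ∧ ∀ k, ∃ P : ℤ[X], P.map (Int.castRingHom ℚ) = C (c : ℚ) * R k := by
  cases nonempty_fintype K
  refine ⟨∏ k, ∏ i ∈ Finset.range ((R k).natDegree + 1), ((R k).coeff i).den,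
    Finset.prod_pos fun k _ => Finset.prod_pos fun i _ => Rat.den_pos _, fun k => ?_⟩
  have := (lifts_iff_coeff_lifts (f := Int.castRingHom ℚ)
    (C ((∏ k, ∏ i ∈ Finset.range ((R k).natDegree + 1), ((R k).coeff i).den : ℕ) : ℚ) * R k)).2
    fun i => ?_
  · exact (mem_lifts _).1 this
  · rw [coeff_C_mul]
    by_cases hi : i ∈ Finset.range ((R k).natDegree + 1)
    · obtain ⟨d, hd⟩ := (Finset.dvd_prod_of_mem (fun i => ((R k).coeff i).den) hi).trans
        (Finset.dvd_prod_of_mem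
          (fun k => ∏ i ∈ Finset.range ((R k).natDegree + 1), ((R k).coeff i).den)
          (Finset.mem_univ k))
      refine ⟨d * ((R k).coeff i).num, ?_⟩
      rw [hd]
      have := Rat.mul_den_eq_num ((R k).coeff i)
      push_cast
      simp only [map_mul, eq_intCast, Int.cast_natCast]
      rw [← this]; ring
    · exact ⟨0, by rw [coeff_eq_zero_of_natDegree_lt (by simpa using hi)]; simp⟩

theorem exists_nat_smul_eq_map_nat {K : Type*} [Finite K] {R : K → ℚ[X]}
    (hR : ∀ k i, 0 ≤ (R k).coeff i) :
    ∃ c : ℕ, 0 < c ∧ ∀ k, ∃ P : ℕ[X], P.map (Nat.castRingHom ℚ) = C (c : ℚ) * R k := by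
  obtain ⟨c, hc, h⟩ := exists_nat_smul_eq_map_int R
  refine ⟨c, hc, fun k => ?_⟩
  obtain ⟨P, hP⟩ := h k
  have := (lifts_iff_coeff_lifts (f := Nat.castRingHom ℚ) (C (c : ℚ) * R k)).2 fun i => ?_
  · exact (mem_lifts _).1 this
  · have h0 : 0 ≤ (C (c : ℚ) * R k).coeff i := by
      rw [coeff_C_mul]; exact mul_nonneg (by positivity) (hR k i)
    rw [← hP, coeff_map, eq_intCast] at h0 ⊢
    obtain ⟨z, hz⟩ := Int.eq_ofNat_of_zero_le (Int.cast_nonneg_iff.1 h0)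
    exact ⟨z, by simp [hz]⟩

/-! ### Natural syzygies, or a point of constant sign -/

theorem coeff_nonneg_mul {p q : ℚ[X]} (hp : ∀ i, 0 ≤ p.coeff i) (hq : ∀ i, 0 ≤ q.coeff i) (i : ℕ) :
    0 ≤ (p * q).coeff i := by
  rw [coeff_mul]
  exact Finset.sum_nonneg fun x _ => mul_nonneg (hp _) (hq _)

theorem eq_zero_of_aeval_pos_eq_zero {p : ℚ[X]} (h : ∀ x : ℝ, 0 < x → aeval x p = 0) : p = 0 := by
  have : p.map (algebraMap ℚ ℝ) = 0 := by
    refine eq_zero_of_infinite_isRoot _ ((Set.Ioi_infinite (0 : ℝ)).mono fun x hx => ?_)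
    rw [Set.mem_ofPred_eq, IsRoot, eval_map_algebraMap]
    exact h x hx
  exact (Polynomial.map_eq_zero _).1 this

/-- If a finite family of rational polynomials takes values of both signs at every positive real
number, then it has a syzygy all of whose entries are nonzero with natural coefficients. -/
theorem exists_nat_syzygy {K : Type*} [Fintype K] {v : K → ℚ[X]}
    (hpos : ∀ x : ℝ, 0 < x → ∃ k, 0 < aeval x (v k))
    (hneg : ∀ x : ℝ, 0 < x → ∃ k, aeval x (v k) < 0) :
    ∃ h : K → ℕ[X], (∀ k, h k ≠ 0) ∧ ∑ k, (h k).map (Nat.castRingHom ℚ) * v k = 0 := by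
  choose w n m hv hw using fun k => exists_unitInterval_model (v k)
  have hpos' : ∀ t ∈ Set.Icc (0 : ℝ) 1, ∃ k, 0 < aeval t (w k) :=
    exists_pos_on_Icc_of_exists_pos_on_Ioo hw fun t ht => by
      have h1 : 0 < 1 - t := by linarith [ht.2]
      have hx : 0 < t / (1 - t) := div_pos ht.1 h1
      obtain ⟨k, hk⟩ := hpos _ hx
      rw [hv k _ hx.le, show t / (1 - t) / (1 + t / (1 - t)) = t by field_simp; ring] at hk
      exact ⟨k, pos_of_mul_pos_right (pos_of_mul_pos_right hk (by positivity)) (by positivity)⟩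
  have hneg' : ∀ t ∈ Set.Icc (0 : ℝ) 1, ∃ k, aeval t (w k) < 0 := by
    have := exists_pos_on_Icc_of_exists_pos_on_Ioo (w := fun k => -w k)
      (fun k => by simpa using hw k) fun t ht => by
        have h1 : 0 < 1 - t := by linarith [ht.2]
        have hx : 0 < t / (1 - t) := div_pos ht.1 h1
        obtain ⟨k, hk⟩ := hneg _ hx
        rw [hv k _ hx.le, show t / (1 - t) / (1 + t / (1 - t)) = t by field_simp; ring] at hk
        refine ⟨k, ?_⟩
        rw [map_neg, neg_pos]
        by_contra! h0
        exact absurd hk (not_lt.2 (by positivity))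
    simpa using this
  obtain ⟨g, hg, hgw⟩ := exists_rat_polynomial_pos_sum_mul_eq_zero hpos' hneg'
  choose N₀ hN₀ using fun k => exists_coeff_nonneg_of_pos_on_unitInterval (hg k)
  set N := ∑ k, N₀ k
  choose H hH0 hH using fun k => hN₀ k N (Finset.single_le_sum (fun _ _ => Nat.zero_le _)
    (Finset.mem_univ k))
  set D := ∑ k, n k
  set M := ∑ k, m k
  have hD : ∀ k, n k ≤ D := fun k => Finset.single_le_sum (fun _ _ => Nat.zero_le _)
    (Finset.mem_univ k)
  have hM : ∀ k, m k ≤ M := fun k => Finset.single_le_sum (fun _ _ => Nat.zero_le _)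
    (Finset.mem_univ k)
  -- The padding gives every product `R k * v k` the same prefactor (1+x)^(N+D) x^M, so the relation
  -- between the `g k * w k` carries over.
  set R : K → ℚ[X] := fun k => H k * ((1 + X) ^ (D - n k) * X ^ (M - m k)) with hRdef
  have hR0 : ∀ k i, 0 ≤ (R k).coeff i := fun k => coeff_nonneg_mul (hH0 k)
    (coeff_nonneg_mul (fun i => by rw [coeff_one_add_X_pow]; positivity)
      fun i => by rw [coeff_X_pow]; positivity)
  have hRv : ∑ k, R k * v k = 0 := by
    refine eq_zero_of_aeval_pos_eq_zero fun x hx => ?_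
    have : ∀ k, aeval x (R k * v k) =
        (1 + x) ^ (N + D) * x ^ M * aeval (x / (1 + x)) (g k * w k) := fun k => by
      simp only [hRdef, map_mul, map_pow, map_add, map_one, aeval_X]
      rw [hH k x hx.le, hv k x hx.le, pow_add, ← Nat.sub_add_cancel (hD k),
        ← Nat.sub_add_cancel (hM k), pow_add _ (D - n k), pow_add _ (M - m k),
        Nat.add_sub_cancel, Nat.add_sub_cancel]
      ring
    rw [map_sum, Finset.sum_congr rfl fun k _ => this k, ← Finset.mul_sum, ← map_sum, hgw,
      map_zero, mul_zero]
  have hRne : ∀ k, R k ≠ 0 := fun k h0 => by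
    have h1 : aeval (1 : ℝ) (R k) = 0 := by rw [h0, map_zero]
    simp only [hRdef, map_mul, map_pow, map_add, map_one, aeval_X] at h1
    rw [hH k 1 zero_le_one] at h1
    have := hg k (1 / (1 + 1)) ⟨by norm_num, by norm_num⟩
    have : 0 < (1 + 1 : ℝ) ^ N * aeval (1 / (1 + 1) : ℝ) (g k) *
      ((1 + 1) ^ (D - n k) * 1 ^ (M - m k)) := by positivity
    exact this.ne' h1
  obtain ⟨c, hc, hP⟩ := exists_nat_smul_eq_map_nat hR0
  choose h hh using hP
  have hc' : (C (c : ℚ)) ≠ 0 := by simpa using hc.ne'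
  refine ⟨h, fun k h0 => ?_, ?_⟩
  · have := hh k
    rw [h0, Polynomial.map_zero] at this
    exact mul_ne_zero hc' (hRne k) this.symm
  · simp only [hh, mul_assoc]
    rw [← Finset.mul_sum, hRv, mul_zero]

/-- Dividing by the gcd leaves quotients without a common real root, by Bézout, so a point of
constant weak sign has a member that is nonzero there. The sign of `d` can be flipped to make it
positive. -/
theorem exists_pos_nonneg_of_not_exists_nat_syzygy {K : Type*} [Fintype K] {u : K → ℚ[X]}
    (hu : ¬∃ h : K → ℕ[X], (∀ k, h k ≠ 0) ∧ ∑ k, (h k).map (Nat.castRingHom ℚ) * u k = 0) :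
    ∃ d : ℚ[X], d ≠ 0 ∧ ∃ v : K → ℚ[X], (∀ k, u k = d * v k) ∧
      ∃ r : ℝ, 0 < r ∧ (∀ k, 0 ≤ aeval r (v k)) ∧ ∃ k, 0 < aeval r (v k) := by
  obtain ⟨d, hd⟩ := IsPrincipalIdealRing.principal (Ideal.span (Set.range u))
  rw [← Ideal.span] at hd
  have hv : ∀ k, ∃ v, u k = d * v := fun k => by
    have : u k ∈ Ideal.span {d} := hd ▸ Ideal.subset_span ⟨k, rfl⟩
    exact Ideal.mem_span_singleton.1 this
  choose v hv using hv
  have hd0 : d ≠ 0 := by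
    rintro rfl
    exact hu ⟨fun _ => 1, fun _ => one_ne_zero, Finset.sum_eq_zero fun k _ => by simp [hv k]⟩
  have hbez : ∃ a : K → ℚ[X], ∑ k, a k * v k = 1 := by
    have : d ∈ Ideal.span (Set.range u) := hd ▸ Ideal.mem_span_singleton_self d
    obtain ⟨a, ha⟩ := (Ideal.mem_span_range_iff_exists_fun).1 this
    refine ⟨a, mul_left_cancel₀ hd0 ?_⟩
    rw [mul_one]
    nth_rw 2 [← ha]
    rw [Finset.mul_sum]
    exact Finset.sum_congr rfl fun k _ => by rw [hv k]; ring
  have hne : ∀ r : ℝ, ∃ k, aeval r (v k) ≠ 0 := fun r => by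
    obtain ⟨a, ha⟩ := hbez
    by_contra! h0
    have := congrArg (aeval r) ha
    simp [h0] at this
  by_cases hsign : ∃ r : ℝ, 0 < r ∧ ((∀ k, 0 ≤ aeval r (v k)) ∨ ∀ k, aeval r (v k) ≤ 0)
  · obtain ⟨r, hr, h | h⟩ := hsign
    · obtain ⟨k, hk⟩ := hne r
      exact ⟨d, hd0, v, hv, r, hr, h, k, lt_of_le_of_ne (h k) hk.symm⟩
    · obtain ⟨k, hk⟩ := hne r
      refine ⟨-d, neg_ne_zero.2 hd0, fun k => -v k, fun k => by rw [hv k]; ring, r, hr,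
        fun k => by simpa using h k, k, ?_⟩
      simpa using lt_of_le_of_ne (h k) hk
  · push Not at hsign
    obtain ⟨h, h0, h1⟩ := exists_nat_syzygy (fun x hx => (hsign x hx).2) fun x hx => (hsign x hx).1
    refine absurd ⟨h, h0, ?_⟩ hu
    have : ∀ k, (h k).map (Nat.castRingHom ℚ) * u k = d * ((h k).map (Nat.castRingHom ℚ) * v k) :=
      fun k => by rw [hv k]; ring
    rw [Finset.sum_congr rfl fun k _ => this k, ← Finset.mul_sum, h1, mul_zero]

/-- At a transcendental `r` no nonzero `v k` vanishes, so all inequalities are strict and persist at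
a nearby rational. -/
theorem exists_integral_pos_nonneg {K : Type*} [Finite K] {v : K → ℚ[X]} {r : ℝ} (hr : 0 < r)
    (hv : ∀ k, 0 ≤ aeval r (v k)) (hpos : ∃ k, 0 < aeval r (v k)) :
    ∃ s : ℝ, IsIntegral ℚ s ∧ 0 < s ∧ (∀ k, 0 ≤ aeval s (v k)) ∧ ∃ k, 0 < aeval s (v k) := by
  by_cases hint : IsIntegral ℚ r
  · exact ⟨r, hint, hr, hv, hpos⟩
  have hne : ∀ k, v k ≠ 0 → 0 < aeval r (v k) := fun k hk =>
    lt_of_le_of_ne (hv k) fun h0 => hint (isAlgebraic_iff_isIntegral.1 ⟨v k, hk, h0.symm⟩)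
  have hev : ∀ᶠ x in nhds r, 0 < x ∧ ∀ k, v k ≠ 0 → 0 < aeval x (v k) :=
    (eventually_gt_nhds hr).and <| Filter.eventually_all.2 fun k => by
      by_cases hk : v k = 0
      · simp [hk]
      · exact (((v k).continuous_aeval (A := ℝ)).continuousAt.eventually_const_lt
          (hne k hk)).mono fun _ hx _ => hx
  obtain ⟨q, hq0, hq⟩ := Rat.isDenseEmbedding_coe_real.dense.exists_mem_open
    (isOpen_interior) (⟨r, mem_interior_iff_mem_nhds.2 hev⟩ : (interior _).Nonempty)
    |>.imp fun q hq => interior_subset hq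
  refine ⟨q, isIntegral_algebraMap (R := ℚ) (x := q), hq0, fun k => ?_, ?_⟩
  · by_cases hk : v k = 0
    · simp [hk]
    · exact (hq k hk).le
  · obtain ⟨k, hk⟩ := hpos
    exact ⟨k, hq k fun h0 => by simp [h0] at hk⟩

/-- Take the minimal polynomial up to sign. Separability makes the root simple, so a sign change can
later witness it. -/
theorem exists_simple_root_polynomial {r : ℝ} (hr : IsIntegral ℚ r) :
    ∃ g : ℚ[X], (∀ p : ℚ[X], aeval r p = 0 → g ∣ p) ∧ aeval r g = 0 ∧
      0 < aeval r (derivative g) := by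
  have hsep := (minpoly.irreducible hr).separable
  have hne : aeval r (derivative (minpoly ℚ r)) ≠ 0 :=
    hsep.aeval_derivative_ne_zero (minpoly.aeval ℚ r)
  rcases hne.lt_or_gt with h | h
  · exact ⟨-minpoly ℚ r, fun p hp => (neg_dvd).2 (minpoly.dvd ℚ r hp), by simp, by simpa using h⟩
  · exact ⟨minpoly ℚ r, fun p hp => minpoly.dvd ℚ r hp, by simp, h⟩

theorem eventually_lt_zero_and_zero_lt {g : ℚ[X]} {r : ℝ} (h0 : aeval r g = 0)
    (h1 : 0 < aeval r (derivative g)) :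
    (∀ᶠ x in nhdsWithin r (Set.Iio r), aeval x g < 0) ∧
      ∀ᶠ x in nhdsWithin r (Set.Ioi r), 0 < aeval x g := by
  have hd : HasDerivAt (fun x : ℝ => aeval x g) (aeval r (derivative g)) r := g.hasDerivAt_aeval r
  have := (hasDerivAt_iff_tendsto_slope.1 hd).eventually_const_lt h1
  refine ⟨?_, ?_⟩
  · filter_upwards [this.filter_mono (nhdsWithin_mono r fun x (hx : x < r) => hx.ne),
      self_mem_nhdsWithin] with x hx hxr
    have hxr' : x - r < 0 := sub_neg.2 hxr
    rw [slope_def_field, h0, sub_zero] at hx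
    by_contra! hge
    exact absurd hx (not_lt.2 (div_nonpos_of_nonneg_of_nonpos hge hxr'.le))
  · filter_upwards [this.filter_mono (nhdsWithin_mono r fun x (hx : r < x) => hx.ne'),
      self_mem_nhdsWithin] with x hx hxr
    have hxr' : 0 < x - r := sub_pos.2 hxr
    rw [slope_def_field, h0, sub_zero] at hx
    exact (div_pos_iff_of_pos_right hxr').1 hx

end

/-! ### Computing with Laurent polynomials given by lists -/

/-- A Laurent polynomial with integer coefficients, written as a list of pairs
(exponent, coefficient). -/
abbrev LaurentCode := List (ℤ × ℤ)

namespace LaurentCode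

/-- The Laurent polynomial that a code stands for. -/
noncomputable def toLaurent (l : LaurentCode) : LaurentPolynomial ℤ :=
  (l.map fun p => AddMonoidAlgebra.single p.1 p.2).sum

/-- The product of two codes. -/
def mul (l m : LaurentCode) : LaurentCode :=
  l.flatMap fun p => m.map fun q => (p.1 + q.1, p.2 * q.2)

/-- The negative of a code. -/
def neg (l : LaurentCode) : LaurentCode := l.map fun p => (p.1, -p.2)

/-- The product of a code with the `k`-th power of the variable. -/
def shift (k : ℤ) (l : LaurentCode) : LaurentCode := l.map fun p => (p.1 + k, p.2)

/-- The coefficient of a code at an exponent. -/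
def coeffAt (l : LaurentCode) (k : ℤ) : ℤ := (l.map fun p => if p.1 = k then p.2 else 0).sum

/-- The code stands for the zero polynomial. -/
def IsZero (l : LaurentCode) : Prop := ∀ p ∈ l, coeffAt l p.1 = 0

/-- A bound for the absolute values of the exponents of a code. -/
def height (l : LaurentCode) : ℕ := (l.map fun p => p.1.natAbs).sum

/-- The value at `a / q` of a term, multiplied by `(a * b * q) ^ N`. -/
def scaledTerm (N a b q : ℕ) (p : ℤ × ℤ) : ℤ :=
  p.2 * (b ^ N * a ^ (N + p.1).toNat * q ^ (N - p.1).toNat : ℕ)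

/-- The value at `a / q` of a code, multiplied by a positive integer. -/
def scaledEval (l : LaurentCode) (a b q : ℕ) : ℤ := (l.map (scaledTerm l.height a b q)).sum

/-- A lower bound for the values of a code between `a / q` and `b / q`, multiplied by a positive
integer. -/
def scaledLower (l : LaurentCode) (a b q : ℕ) : ℤ :=
  (l.map fun p => min (scaledTerm l.height a b q p) (scaledTerm l.height b a q p)).sum

/-- The value of a code at a real number. -/
noncomputable def realEval (l : LaurentCode) (x : ℝ) : ℝ :=
  (l.map fun p => (p.2 : ℝ) * x ^ p.1).sum

/-- A lower bound for the values of a code between `x` and `y`. -/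
noncomputable def realLower (l : LaurentCode) (x y : ℝ) : ℝ :=
  (l.map fun p => min ((p.2 : ℝ) * x ^ p.1) ((p.2 : ℝ) * y ^ p.1)).sum

@[simp]
theorem toLaurent_nil : toLaurent [] = 0 := rfl

@[simp]
theorem toLaurent_cons (p : ℤ × ℤ) (l : LaurentCode) :
    toLaurent (p :: l) = AddMonoidAlgebra.single p.1 p.2 + toLaurent l := rfl

@[simp]
theorem toLaurent_append (l m : LaurentCode) : toLaurent (l ++ m) = toLaurent l + toLaurent m := by
  simp [toLaurent]

@[simp]
theorem toLaurent_neg (l : LaurentCode) : toLaurent (neg l) = -toLaurent l := by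
  induction l with
  | nil => simp [neg]
  | cons p l ih =>
    change toLaurent ((p.1, -p.2) :: neg l) = _
    rw [toLaurent_cons, toLaurent_cons, ih, AddMonoidAlgebra.single_neg, neg_add]

@[simp]
theorem toLaurent_shift (k : ℤ) (l : LaurentCode) :
    toLaurent (shift k l) = LaurentPolynomial.T k * toLaurent l := by
  induction l with
  | nil => simp [shift]
  | cons p l ih =>
    change toLaurent ((p.1 + k, p.2) :: shift k l) = _
    rw [toLaurent_cons, toLaurent_cons, ih, mul_add, LaurentPolynomial.T,
      AddMonoidAlgebra.single_mul_single, one_mul, add_comm k]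

@[simp]
theorem toLaurent_mul (l m : LaurentCode) : toLaurent (mul l m) = toLaurent l * toLaurent m := by
  induction l with
  | nil => simp [mul]
  | cons p l ih =>
    change toLaurent ((m.map fun q => (p.1 + q.1, p.2 * q.2)) ++ mul l m) = _
    rw [toLaurent_append, toLaurent_cons, ih, add_mul]
    congr 1
    clear ih
    induction m with
    | nil => simp
    | cons q m ih =>
      rw [List.map_cons, toLaurent_cons, toLaurent_cons, ih, mul_add,
        AddMonoidAlgebra.single_mul_single]

theorem coeff_toLaurent (l : LaurentCode) (k : ℤ) : (toLaurent l).coeff k = coeffAt l k := by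
  induction l with
  | nil => simp [coeffAt]
  | cons p l ih =>
    rw [toLaurent_cons, AddMonoidAlgebra.coeff_add, Finsupp.add_apply, ih,
      AddMonoidAlgebra.coeff_single, Finsupp.single_apply]
    simp [coeffAt]

theorem isZero_iff (l : LaurentCode) : IsZero l ↔ toLaurent l = 0 := by
  constructor
  · intro h
    refine LaurentPolynomial.ext fun k => ?_
    rw [coeff_toLaurent, AddMonoidAlgebra.coeff_zero, Finsupp.zero_apply]
    by_cases hk : ∃ p ∈ l, p.1 = k
    · obtain ⟨p, hp, rfl⟩ := hk
      exact h p hp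
    · refine List.sum_eq_zero fun x hx => ?_
      obtain ⟨p, hp, rfl⟩ := List.mem_map.1 hx
      exact if_neg fun h => hk ⟨p, hp, h⟩
  · intro h p _
    rw [← coeff_toLaurent, h]; simp

theorem toLaurent_surjective : Function.Surjective toLaurent := by
  intro f
  induction f using LaurentPolynomial.induction_on' with
  | add p q hp hq =>
    obtain ⟨l, rfl⟩ := hp
    obtain ⟨m, rfl⟩ := hq
    exact ⟨l ++ m, toLaurent_append l m⟩
  | C_mul_T n a =>
    exact ⟨[(n, a)], by simp [LaurentPolynomial.single_eq_C_mul_T]⟩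

theorem realEval_eq (l : LaurentCode) (x : ℝˣ) :
    realEval l x = LaurentPolynomial.eval₂ (Int.castRingHom ℝ) x (toLaurent l) := by
  induction l with
  | nil => simp [realEval]
  | cons p l ih =>
    rw [toLaurent_cons, map_add, ← ih, LaurentPolynomial.single_eq_C_mul_T,
      LaurentPolynomial.eval₂_C_mul_T]
    simp [realEval]

theorem realEval_of_toLaurent_eq {l : LaurentCode} {P : Polynomial ℤ}
    (h : toLaurent l = Polynomial.toLaurent P) {x : ℝ} (hx : x ≠ 0) :
    realEval l x = Polynomial.aeval x P := by
  have := realEval_eq l (Units.mk0 x hx)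
  rw [h, LaurentPolynomial.eval₂_toLaurent] at this
  exact this

theorem natAbs_le_height {l : LaurentCode} {p : ℤ × ℤ} (hp : p ∈ l) : p.1.natAbs ≤ height l :=
  List.single_le_sum (fun _ _ => Nat.zero_le _) _ (List.mem_map.2 ⟨p, hp, rfl⟩)

theorem scaledTerm_eq {N a b q : ℕ} (ha : 0 < a) (hq : 0 < q) {p : ℤ × ℤ}
    (hp : p.1.natAbs ≤ N) : (scaledTerm N a b q p : ℝ) =
      ((a : ℝ) * b * q) ^ N * ((p.2 : ℝ) * ((a : ℝ) / q) ^ p.1) := by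
  have ha' : (a : ℝ) ≠ 0 := by positivity
  have hq' : (q : ℝ) ≠ 0 := by positivity
  have h1 : ((N + p.1).toNat : ℤ) = N + p.1 := Int.toNat_of_nonneg (by omega)
  have h2 : ((N - p.1).toNat : ℤ) = N - p.1 := Int.toNat_of_nonneg (by omega)
  have e1 : (a : ℝ) ^ (N + p.1).toNat = a ^ N * (a : ℝ) ^ p.1 := by
    rw [← zpow_natCast, h1, zpow_add₀ ha', zpow_natCast]
  have e2 : (q : ℝ) ^ (N - p.1).toNat = q ^ N / (q : ℝ) ^ p.1 := by
    rw [← zpow_natCast, h2, zpow_sub₀ hq', zpow_natCast]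
  rw [scaledTerm]
  push_cast
  rw [e1, e2, div_zpow]
  ring

theorem scaledEval_eq (l : LaurentCode) {a q : ℕ} (b : ℕ) (ha : 0 < a) (hq : 0 < q) :
    (scaledEval l a b q : ℝ) = ((a : ℝ) * b * q) ^ l.height * realEval l (a / q) := by
  rw [scaledEval, realEval, ← List.sum_map_mul_left, Int.cast_list_sum, List.map_map]
  congr 1
  exact List.map_congr_left fun p hp => scaledTerm_eq ha hq (natAbs_le_height hp)

theorem scaledLower_eq (l : LaurentCode) {a b q : ℕ} (ha : 0 < a) (hb : 0 < b) (hq : 0 < q) :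
    (scaledLower l a b q : ℝ) =
      ((a : ℝ) * b * q) ^ l.height * realLower l (a / q) (b / q) := by
  rw [scaledLower, realLower, ← List.sum_map_mul_left, Int.cast_list_sum, List.map_map]
  congr 1
  refine List.map_congr_left fun p hp => ?_
  rw [Function.comp_apply, Int.cast_min, scaledTerm_eq ha hq (natAbs_le_height hp),
    scaledTerm_eq hb hq (natAbs_le_height hp), mul_comm (b : ℝ) a,
    mul_min_of_nonneg _ _ (by positivity)]

/-- A monomial is monotone on the positive half-line, so its minimum over an interval is attained at
an endpoint. Summing over the terms makes `realLower` a valid bound. -/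
theorem min_mul_zpow_le {x y z : ℝ} (hx : 0 < x) (hxz : x ≤ z) (hzy : z ≤ y) (c : ℝ) (k : ℤ) :
    min (c * x ^ k) (c * y ^ k) ≤ c * z ^ k := by
  have hz : 0 < z := hx.trans_le hxz
  have h : (x ^ k ≤ z ^ k ∧ z ^ k ≤ y ^ k) ∨ (y ^ k ≤ z ^ k ∧ z ^ k ≤ x ^ k) := by
    rcases le_total 0 k with hk | hk
    · exact Or.inl ⟨zpow_le_zpow_left₀ hk hx.le hxz, zpow_le_zpow_left₀ hk hz.le hzy⟩
    · obtain ⟨j, rfl⟩ : ∃ j, k = -j := ⟨-k, by ring⟩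
      have hj : 0 ≤ j := by omega
      simp only [zpow_neg]
      exact Or.inr ⟨inv_anti₀ (zpow_pos hz j) (zpow_le_zpow_left₀ hj hz.le hzy),
        inv_anti₀ (zpow_pos hx j) (zpow_le_zpow_left₀ hj hx.le hxz)⟩
  rcases le_total 0 c with hc | hc <;> rcases h with ⟨h1, h2⟩ | ⟨h1, h2⟩
  · exact min_le_of_left_le (mul_le_mul_of_nonneg_left h1 hc)
  · exact min_le_of_right_le (mul_le_mul_of_nonneg_left h1 hc)
  · exact min_le_of_right_le (mul_le_mul_of_nonpos_left h2 hc)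
  · exact min_le_of_left_le (mul_le_mul_of_nonpos_left h2 hc)

theorem realLower_le (l : LaurentCode) {x y z : ℝ} (hx : 0 < x) (hy : 0 < y)
    (hz : z ∈ Set.uIcc x y) : realLower l x y ≤ realEval l z := by
  refine List.sum_le_sum fun p _ => ?_
  rcases Set.mem_uIcc.1 hz with h | h
  · exact min_mul_zpow_le hx h.1 h.2 _ _
  · rw [min_comm]
    exact min_mul_zpow_le hy h.1 h.2 _ _

theorem continuousAt_realEval (l : LaurentCode) {x : ℝ} (hx : x ≠ 0) :
    ContinuousAt (realEval l) x := by
  induction l with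
  | nil => exact continuousAt_const
  | cons p l ih =>
    have : realEval (p :: l) = fun x => (p.2 : ℝ) * x ^ p.1 + realEval l x := by
      funext x; simp [realEval]
    rw [this]
    exact (continuousAt_const.mul (continuousAt_zpow₀ x p.1 (Or.inl hx))).add ih

theorem tendsto_realLower (l : LaurentCode) {x : ℝ} (hx : x ≠ 0) :
    Filter.Tendsto (fun z : ℝ × ℝ => realLower l z.1 z.2) (nhds x ×ˢ nhds x)
      (nhds (realEval l x)) := by
  induction l with
  | nil => exact tendsto_const_nhds
  | cons p l ih =>
    have e1 : (fun z : ℝ × ℝ => realLower (p :: l) z.1 z.2) = fun z : ℝ × ℝ =>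
        min ((p.2 : ℝ) * z.1 ^ p.1) ((p.2 : ℝ) * z.2 ^ p.1) + realLower l z.1 z.2 := by
      funext x; simp [realLower]
    have e2 : realEval (p :: l) x = min ((p.2 : ℝ) * x ^ p.1) ((p.2 : ℝ) * x ^ p.1)
        + realEval l x := by
      simp [realEval]
    have h : Filter.Tendsto (fun x : ℝ => (p.2 : ℝ) * x ^ p.1) (nhds x)
        (nhds ((p.2 : ℝ) * x ^ p.1)) :=
      continuousAt_const.mul (continuousAt_zpow₀ x p.1 (Or.inl hx))
    rw [e1, e2]
    exact ((h.comp Filter.tendsto_fst).min (h.comp Filter.tendsto_snd)).add ih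

end LaurentCode

/-! ### Certificates that no positive syzygy exists -/

/-- A candidate `(C, D, g, (a, b, q), E)` for a proof that a list of Laurent polynomials has no
positive syzygy. -/
abbrev ObstructionCode :=
  LaurentCode × LaurentCode × LaurentCode × (ℕ × ℕ × ℕ) × List (Bool × LaurentCode)

namespace ObstructionCode

open LaurentCode

/-- The Laurent polynomial that an entry of the list `E` stands for: it is a multiple of `g` if the
entry is flagged. -/
def entry (c : ObstructionCode) (e : Bool × LaurentCode) : LaurentCode :=
  if e.1 = true then mul c.2.2.1 e.2 else e.2

/-- The entry `e` is equal to `u` up to the factors `C` and `D`. -/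
def Matches (c : ObstructionCode) (e : Bool × LaurentCode) (u : LaurentCode) : Prop :=
  IsZero (mul c.1 u ++ neg (mul c.2.1 (entry c e)))

/-- The polynomial `g` has a root between `a / q` and `b / q` at which, up to the common
factor `D / C`, all members of `U` are nonnegative and one of them is positive. -/
def Obstructs (c : ObstructionCode) (U : List LaurentCode) : Prop :=
  ((0 < c.2.2.2.1.1 ∧ 0 < c.2.2.2.1.2.1 ∧ 0 < c.2.2.2.1.2.2) ∧
    ¬IsZero c.2.1 ∧
    scaledEval c.2.2.1 c.2.2.2.1.1 c.2.2.2.1.2.1 c.2.2.2.1.2.2 < 0 ∧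
    0 < scaledEval c.2.2.1 c.2.2.2.1.2.1 c.2.2.2.1.1 c.2.2.2.1.2.2) ∧
  (∀ e ∈ c.2.2.2.2,
    e.1 = true ∨ 0 < scaledLower e.2 c.2.2.2.1.1 c.2.2.2.1.2.1 c.2.2.2.1.2.2) ∧
  (∀ u ∈ U, ∃ e ∈ c.2.2.2.2, Matches c e u) ∧
  ∃ u ∈ U, ∃ e ∈ c.2.2.2.2, e.1 = false ∧ Matches c e u

theorem matches_iff (c : ObstructionCode) (e : Bool × LaurentCode) (u : LaurentCode) :
    Matches c e u ↔ toLaurent c.1 * toLaurent u = toLaurent c.2.1 * toLaurent (entry c e) := by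
  rw [Matches, isZero_iff, toLaurent_append, toLaurent_neg, toLaurent_mul, toLaurent_mul,
    ← sub_eq_add_neg, sub_eq_zero]

/-- Evaluate a supposed relation at a root of `g` in the interval: flagged entries vanish, the
others are positive, and at least one unflagged entry occurs. Any root of `g` there will do, so the
certificate need not isolate one. -/
theorem Obstructs.sum_mul_ne_zero {c : ObstructionCode} {U : List LaurentCode}
    (hc : c.Obstructs U) {K : Type*} {s : Finset K} {u : K → LaurentCode}
    (hsU : ∀ k ∈ s, u k ∈ U) (hUs : ∀ x ∈ U, ∃ k ∈ s, u k = x) {h : K → LaurentPolynomial ℤ}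
    (hpos : ∀ k ∈ s, ∀ x : ℝˣ, 0 < (x : ℝ) →
      0 < LaurentPolynomial.eval₂ (Int.castRingHom ℝ) x (h k)) :
    ∑ k ∈ s, h k * toLaurent (u k) ≠ 0 := by
  obtain ⟨C, D, g, ⟨a, b, q⟩, E⟩ := c
  obtain ⟨⟨⟨ha, hb, hq⟩, hD, hga, hgb⟩, hE, hUE, u₀, hu₀, e₀, he₀, hflag, hmatch⟩ := hc
  simp only at ha hb hq hD hga hgb hE hUE he₀
  intro hsum
  have ha' : (0 : ℝ) < a := by exact_mod_cast ha
  have hb' : (0 : ℝ) < b := by exact_mod_cast hb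
  have hq' : (0 : ℝ) < q := by exact_mod_cast hq
  have hx : (0 : ℝ) < a / q := by positivity
  have hy : (0 : ℝ) < b / q := by positivity
  have hgx : realEval g (a / q) < 0 := by
    have : (scaledEval g a b q : ℝ) < 0 := by exact_mod_cast hga
    rw [scaledEval_eq g b ha hq] at this
    by_contra! h0
    exact absurd this (not_lt.2 (by positivity))
  have hgy : 0 < realEval g (b / q) := by
    have : (0 : ℝ) < (scaledEval g b a q : ℝ) := by exact_mod_cast hgb
    rw [scaledEval_eq g a hb hq] at this
    exact pos_of_mul_pos_right this (by positivity)
  have hsub : ∀ z ∈ Set.uIcc ((a : ℝ) / q) (b / q), 0 < z := fun z hz =>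
    (lt_min hx hy).trans_le hz.1
  obtain ⟨r, hr, hgr⟩ := intermediate_value_uIcc (f := realEval g)
    (fun z hz => (continuousAt_realEval g (hsub z hz).ne').continuousWithinAt)
    (Set.mem_uIcc_of_le hgx.le hgy.le)
  have hr0 : 0 < r := hsub r hr
  set ρ : ℝˣ := Units.mk0 r hr0.ne'
  have hlow : ∀ l : LaurentCode, 0 < scaledLower l a b q →
      0 < LaurentPolynomial.eval₂ (Int.castRingHom ℝ) ρ (toLaurent l) := fun l hl => by
    have : (0 : ℝ) < (scaledLower l a b q : ℝ) := by exact_mod_cast hl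
    rw [scaledLower_eq l ha hb hq] at this
    rw [← realEval_eq]
    exact (pos_of_mul_pos_right this (by positivity)).trans_le (realLower_le l hx hy hr)
  have hev : ∀ e ∈ E, 0 ≤ LaurentPolynomial.eval₂ (Int.castRingHom ℝ) ρ
      (toLaurent (entry (C, D, g, (a, b, q), E) e)) := fun e he => by
    rw [entry]
    split_ifs with hf
    · rw [toLaurent_mul, map_mul, ← realEval_eq]
      change 0 ≤ realEval g r * _
      rw [hgr, zero_mul]
    · exact (hlow _ ((hE e he).resolve_left hf)).le
  have hD' : toLaurent D ≠ 0 := fun h0 => hD ((isZero_iff D).2 h0)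
  have hchoice : ∀ k, ∃ e, k ∈ s → e ∈ E ∧ Matches (C, D, g, (a, b, q), E) e (u k) := fun k => by
    by_cases hk : k ∈ s
    · obtain ⟨e, he⟩ := hUE _ (hsU k hk)
      exact ⟨e, fun _ => he⟩
    · exact ⟨(true, []), fun h => absurd h hk⟩
  choose e he using hchoice
  -- Multiply the relation by C, replace C·u by D·entry and cancel D. Only D must be nonzero.
  have hsum' : ∑ k ∈ s, h k * toLaurent (entry (C, D, g, (a, b, q), E) (e k)) = 0 := by
    refine mul_left_cancel₀ hD' ?_
    rw [mul_zero, ← mul_zero (toLaurent C), ← hsum, Finset.mul_sum, Finset.mul_sum]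
    refine Finset.sum_congr rfl fun k hk => ?_
    have := (matches_iff _ _ _).1 (he k hk).2
    simp only at this
    rw [mul_left_comm, ← this, mul_left_comm]
  obtain ⟨k₀, hk₀, hk₀u⟩ := hUs u₀ hu₀
  have hk₀pos : 0 < LaurentPolynomial.eval₂ (Int.castRingHom ℝ) ρ
      (toLaurent (entry (C, D, g, (a, b, q), E) (e k₀))) := by
    have h1 := (matches_iff _ _ _).1 (he k₀ hk₀).2
    have h2 := (matches_iff _ _ _).1 hmatch
    rw [hk₀u, h2] at h1
    rw [← mul_left_cancel₀ hD' h1, entry, if_neg (by simp [hflag])]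
    exact hlow _ ((hE e₀ he₀).resolve_left (by simp [hflag]))
  have := congrArg (LaurentPolynomial.eval₂ (Int.castRingHom ℝ) ρ) hsum'
  rw [map_sum, map_zero] at this
  refine (Finset.sum_pos' (fun k hk => ?_) ⟨k₀, hk₀, ?_⟩).ne' this
  · rw [map_mul]
    exact mul_nonneg (hpos k hk ρ hr0).le (hev _ (he k hk).1)
  · rw [map_mul]
    exact mul_pos (hpos k₀ hk₀ ρ hr0) hk₀pos

theorem exists_rat_lt_of_eventually {r : ℝ} {p : ℝ → Prop} (hr : 0 < r)
    (hp : ∀ᶠ x in nhdsWithin r (Set.Iio r), p x) : ∃ x : ℚ, 0 < x ∧ p x := by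
  obtain ⟨l, hl, hp⟩ := mem_nhdsLT_iff_exists_Ioo_subset.1 hp
  obtain ⟨x, hx1, hx2⟩ := exists_rat_btwn (max_lt hl hr)
  exact ⟨x, by exact_mod_cast (le_max_right _ _).trans_lt hx1,
    hp ⟨(le_max_left _ _).trans_lt hx1, hx2⟩⟩

theorem exists_rat_gt_of_eventually {r : ℝ} {p : ℝ → Prop} (hr : 0 < r)
    (hp : ∀ᶠ x in nhdsWithin r (Set.Ioi r), p x) : ∃ x : ℚ, 0 < x ∧ p x := by
  obtain ⟨l, hl, hp⟩ := mem_nhdsGT_iff_exists_Ioo_subset.1 hp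
  obtain ⟨x, hx1, hx2⟩ := exists_rat_btwn (show r < l from hl)
  exact ⟨x, by exact_mod_cast hr.trans hx1, hp ⟨hx1, hx2⟩⟩

theorem exists_common_den {x y : ℚ} (hx : 0 < x) (hy : 0 < y) :
    ∃ a b q : ℕ, 0 < a ∧ 0 < b ∧ 0 < q ∧ (x : ℝ) = a / q ∧ (y : ℝ) = b / q := by
  have key : ∀ {x : ℚ}, 0 < x → 0 < x.num.toNat ∧ (x : ℝ) = x.num.toNat / x.den := fun {x} hx => by
    have h := Rat.num_pos.2 hx
    refine ⟨by omega, ?_⟩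
    have : (x.num : ℝ) = x.num.toNat := by
      exact_mod_cast (Int.toNat_of_nonneg h.le).symm
    rw [← this]; exact_mod_cast (Rat.num_div_den x).symm
  obtain ⟨h1, h2⟩ := key hx
  obtain ⟨h3, h4⟩ := key hy
  have h5 : (0 : ℝ) < x.den := by exact_mod_cast x.den_pos
  have h6 : (0 : ℝ) < y.den := by exact_mod_cast y.den_pos
  refine ⟨x.num.toNat * y.den, y.num.toNat * x.den, x.den * y.den, Nat.mul_pos h1 y.den_pos,
    Nat.mul_pos h3 x.den_pos, Nat.mul_pos x.den_pos y.den_pos, ?_, ?_⟩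
  · rw [h2]; push_cast; field_simp
  · rw [h4]; push_cast; field_simp

theorem exists_toLaurent_eq_mul_T {K : Type*} [Finite K] (f : K → LaurentPolynomial ℤ) :
    ∃ (n : ℕ) (P : K → Polynomial ℤ), ∀ k, Polynomial.toLaurent (P k) =
      f k * LaurentPolynomial.T n := by
  cases nonempty_fintype K
  choose n P hP using fun k => LaurentPolynomial.exists_T_pow (f k)
  refine ⟨∑ k, n k, fun k => P k * Polynomial.X ^ (∑ k, n k - n k), fun k => ?_⟩
  have hk : n k ≤ ∑ k, n k := Finset.single_le_sum (fun _ _ => Nat.zero_le _) (Finset.mem_univ k)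
  rw [map_mul, hP, Polynomial.toLaurent_X_pow, mul_assoc, ← LaurentPolynomial.T_add,
    ← Nat.cast_add, Nat.add_sub_cancel' hk]

open Polynomial in
/-- A finite family of Laurent polynomials without a positive syzygy has an obstruction. -/
theorem exists_obstructs {K : Type*} [Fintype K] {u : K → LaurentCode} {U : List LaurentCode}
    (hU : ∀ x, x ∈ U ↔ ∃ k, u k = x)
    (hno : ¬∃ h : K → ℕ[X], (∀ k, h k ≠ 0) ∧
      ∑ k, Polynomial.toLaurent ((h k).map (Nat.castRingHom ℤ)) * toLaurent (u k) = 0) :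
    ∃ c : ObstructionCode, c.Obstructs U := by
  obtain ⟨n, P, hP⟩ := exists_toLaurent_eq_mul_T fun k => toLaurent (u k)
  have hinj : Function.Injective (map (Int.castRingHom ℚ)) :=
    map_injective _ Int.cast_injective
  have hno' : ¬∃ h : K → ℕ[X], (∀ k, h k ≠ 0) ∧
      ∑ k, (h k).map (Nat.castRingHom ℚ) * (P k).map (Int.castRingHom ℚ) = 0 := by
    rintro ⟨h, h0, hs⟩
    refine hno ⟨h, h0, ?_⟩
    have hz : ∑ k, (h k).map (Nat.castRingHom ℤ) * P k = 0 := by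
      apply hinj
      rw [Polynomial.map_sum, Polynomial.map_zero, ← hs]
      refine Finset.sum_congr rfl fun k _ => ?_
      rw [Polynomial.map_mul, Polynomial.map_map]
      congr 2
    have hz' := congrArg Polynomial.toLaurent hz
    rw [map_sum, map_zero] at hz'
    simp only [map_mul, hP, ← mul_assoc] at hz'
    rw [← Finset.sum_mul] at hz'
    exact (LaurentPolynomial.isUnit_T (n : ℤ)).mul_left_eq_zero.1 hz'
  obtain ⟨d, hd, v, hv, r₀, hr₀, hge₀, hpos₀⟩ := exists_pos_nonneg_of_not_exists_nat_syzygy hno'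
  obtain ⟨r, hint, hr, hge, k₀, hk₀⟩ := exists_integral_pos_nonneg hr₀ hge₀ hpos₀
  obtain ⟨g, hgdvd, hgr, hgr'⟩ := exists_simple_root_polynomial hint
  obtain ⟨hlt, hgt⟩ := eventually_lt_zero_and_zero_lt hgr hgr'
  obtain ⟨γ, hγ, hG⟩ := exists_nat_smul_eq_map_int fun _ : Unit => g
  obtain ⟨G, hG⟩ := hG ()
  obtain ⟨δ, hδ, hD⟩ := exists_nat_smul_eq_map_int fun _ : Unit => d
  obtain ⟨D, hD⟩ := hD ()
  have hγ' : (C (γ : ℚ)) ≠ 0 := by simpa using hγ.ne'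
  have hδ' : (C (δ : ℚ)) ≠ 0 := by simpa using hδ.ne'
  have hw : ∀ k, ∃ w : ℚ[X], aeval r (v k) = 0 → v k = G.map (Int.castRingHom ℚ) * w := fun k => by
    by_cases h0 : aeval r (v k) = 0
    · obtain ⟨w, hw⟩ := hgdvd _ h0
      refine ⟨C ((γ : ℚ)⁻¹) * w, fun _ => ?_⟩
      rw [hG, hw, mul_comm (C (γ : ℚ)), mul_assoc, ← mul_assoc (C (γ : ℚ)), ← C_mul,
        mul_inv_cancel₀ (by exact_mod_cast hγ.ne'), C_1, one_mul]
    · exact ⟨0, fun h => absurd h h0⟩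
  choose w hw using hw
  classical
  -- A quotient vanishing at `r` is stored through its cofactor with respect to `G`, any other
  -- quotient as it is; ε clears all denominators.
  obtain ⟨ε, hε, hF⟩ := exists_nat_smul_eq_map_int
    fun k => if aeval r (v k) = 0 then w k else v k
  choose F hF using hF
  -- The factor C collects the cleared denominators of the entries and of `d`, and the power of X
  -- that made the `u k` polynomials.
  obtain ⟨cC, hcC⟩ := toLaurent_surjective (LaurentPolynomial.C ((ε * δ : ℕ) : ℤ) *
    LaurentPolynomial.T (n : ℤ))
  obtain ⟨cD, hcD⟩ := toLaurent_surjective (Polynomial.toLaurent D)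
  obtain ⟨cG, hcG⟩ := toLaurent_surjective (Polynomial.toLaurent G)
  choose cF hcF using fun k => toLaurent_surjective (Polynomial.toLaurent (F k))
  have aevalInt : ∀ (x : ℝ) (Q : ℤ[X]), aeval x Q = aeval x (Q.map (Int.castRingHom ℚ)) :=
    fun x Q => (aeval_map_algebraMap ℚ x Q).symm
  have hlowF : ∀ᶠ z in nhds r ×ˢ nhds r, ∀ k, aeval r (v k) ≠ 0 →
      0 < realLower (cF k) z.1 z.2 := by
    refine Filter.eventually_all.2 fun k => ?_
    by_cases h0 : aeval r (v k) = 0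
    · exact Filter.Eventually.of_forall fun _ h => absurd h0 h
    · have hpos : 0 < realEval (cF k) r := by
        rw [realEval_of_toLaurent_eq (hcF k) hr.ne', aevalInt, hF, if_neg h0, map_mul, aeval_C]
        have := lt_of_le_of_ne (hge k) (Ne.symm h0)
        have : (0 : ℝ) < ε := by exact_mod_cast hε
        simp only [map_natCast]
        positivity
      exact ((tendsto_realLower (cF k) hr.ne').eventually_const_lt hpos).mono fun _ hz _ => hz
  -- The lower bounds tend to the values at `r` as both endpoints do, so a single neighbourhood
  -- serves for the rational endpoints on either side.
  obtain ⟨t, ht, hlow⟩ := (Filter.eventually_prod_self_iff (r := fun x y =>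
    ∀ k, aeval r (v k) ≠ 0 → 0 < realLower (cF k) x y)).1 hlowF
  obtain ⟨x, hx0, hxg, hxt⟩ := exists_rat_lt_of_eventually hr
    (hlt.and (nhdsWithin_le_nhds ht))
  obtain ⟨y, hy0, hyg, hyt⟩ := exists_rat_gt_of_eventually hr
    (hgt.and (nhdsWithin_le_nhds ht))
  obtain ⟨a, b, q, ha, hb, hq, hxa, hyb⟩ := exists_common_den hx0 hy0
  have hqR : (0 : ℝ) < q := by exact_mod_cast hq
  have haR : (0 : ℝ) < a := by exact_mod_cast ha
  have hbR : (0 : ℝ) < b := by exact_mod_cast hb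
  have hGval : ∀ z : ℝ, 0 < z → realEval cG z = γ * aeval z g := fun z hz => by
    rw [realEval_of_toLaurent_eq hcG hz.ne', aevalInt, hG, map_mul, aeval_C]; simp
  have hγR : (0 : ℝ) < γ := by exact_mod_cast hγ
  rw [hxa] at hxg hxt
  rw [hyb] at hyg hyt
  set E : K → Bool × LaurentCode := fun k => (decide (aeval r (v k) = 0), cF k)
  set c : ObstructionCode := (cC, cD, cG, (a, b, q), Finset.univ.toList.map E) with hc
  have hmatch : ∀ k, Matches c (E k) (u k) := fun k => by
    rw [matches_iff]
    have hent : toLaurent (entry c (E k)) =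
        Polynomial.toLaurent (if aeval r (v k) = 0 then G * F k else F k) := by
      rw [entry]
      by_cases h0 : aeval r (v k) = 0
      · rw [if_pos (by simp [E, h0]), if_pos h0, toLaurent_mul, map_mul, ← hcG, ← hcF]
      · rw [if_neg (by simp [E, h0]), if_neg h0, ← hcF]
    rw [hent]
    change toLaurent cC * _ = toLaurent cD * _
    rw [hcC, hcD, mul_assoc, mul_comm _ (toLaurent (u k)), ← hP, ← Polynomial.toLaurent_C,
      ← map_mul, ← map_mul]
    congr 1
    apply hinj
    rw [Polynomial.map_mul, Polynomial.map_mul, hD, Polynomial.map_C, hv]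
    have hCC : (C ((Int.castRingHom ℚ) ((ε * δ : ℕ) : ℤ)) : ℚ[X]) = C (ε : ℚ) * C (δ : ℚ) := by
      rw [← C_mul]; simp
    rw [hCC]
    by_cases h0 : aeval r (v k) = 0
    · have h1 := hF k
      rw [if_pos h0] at h1
      rw [if_pos h0, Polynomial.map_mul, h1, hw k h0]; ring
    · have h1 := hF k
      rw [if_neg h0] at h1
      rw [if_neg h0, h1]; ring
  refine ⟨c, ⟨⟨ha, hb, hq⟩, fun h0 => ?_, ?_, ?_⟩, fun e he => ?_, fun z hz => ?_, ?_⟩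
  · have h1 : toLaurent cD = 0 := (isZero_iff _).1 h0
    rw [hcD, Polynomial.toLaurent_eq_zero] at h1
    rw [h1, Polynomial.map_zero] at hD
    exact mul_ne_zero hδ' hd hD.symm
  · have h1 : (scaledEval cG a b q : ℝ) < 0 := by
      rw [scaledEval_eq cG b ha hq, hGval _ (by positivity)]
      exact mul_neg_of_pos_of_neg (by positivity) (mul_neg_of_pos_of_neg hγR hxg)
    exact_mod_cast h1
  · have h1 : 0 < (scaledEval cG b a q : ℝ) := by
      rw [scaledEval_eq cG a hb hq, hGval _ (by positivity)]
      positivity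
    exact_mod_cast h1
  · obtain ⟨k, -, rfl⟩ := List.mem_map.1 he
    by_cases h0 : aeval r (v k) = 0
    · exact Or.inl (by simp [E, h0])
    · refine Or.inr ?_
      have h1 : 0 < (scaledLower (cF k) a b q : ℝ) := by
        rw [scaledLower_eq _ ha hb hq]
        exact mul_pos (by positivity) (hlow _ hxt _ hyt k h0)
      exact_mod_cast h1
  · obtain ⟨k, rfl⟩ := (hU z).1 hz
    exact ⟨E k, List.mem_map.2 ⟨k, by simp, rfl⟩, hmatch k⟩
  · exact ⟨u k₀, (hU _).2 ⟨k₀, rfl⟩, E k₀, List.mem_map.2 ⟨k₀, by simp, rfl⟩,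
      by simp [E, hk₀.ne'], hmatch k₀⟩

end ObstructionCode

/-! ### Neutral words in which every generator occurs -/

namespace ZWrZ

open LaurentCode

/-- The products of nonempty words over a list of codes. -/
theorem mem_closure_generators_iff {L : List (List (ℤ × ℤ) × ℤ)} {x : ZWrZ} :
    x ∈ Subsemigroup.closure (generators L) ↔
      ∃ w : List (List (ℤ × ℤ) × ℤ), w ≠ [] ∧ (∀ c ∈ w, c ∈ L) ∧ (w.map ofCode).prod = x := by
  constructor
  · intro hx
    induction hx using Subsemigroup.closure_induction with
    | mem x hx =>
      obtain ⟨c, hc, rfl⟩ := hx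
      exact ⟨[c], by simp, by simpa using hc, by simp⟩
    | mul x y _ _ hx hy =>
      obtain ⟨w, h1, h2, rfl⟩ := hx
      obtain ⟨w', h1', h2', rfl⟩ := hy
      refine ⟨w ++ w', by simp [h1], fun c hc => ?_, by simp⟩
      exact (List.mem_append.1 hc).elim (h2 c) (h2' c)
  · rintro ⟨w, hw, hL, rfl⟩
    induction w with
    | nil => exact absurd rfl hw
    | cons c w ih =>
      have hc : ofCode c ∈ Subsemigroup.closure (generators L) :=
        Subsemigroup.subset_closure ⟨c, hL c (by simp), rfl⟩
      rcases eq_or_ne w [] with rfl | hne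
      · simpa using hc
      · rw [List.map_cons, List.prod_cons]
        exact mul_mem hc (ih hne fun d hd => hL d (by simp [hd]))

/-- Some nonempty product of members of `L` in which every member of `L` occurs is neutral. -/
def IsFullRelator (L w : List (List (ℤ × ℤ) × ℤ)) : Prop :=
  w ≠ [] ∧ (∀ c ∈ w, c ∈ L) ∧ (∀ c ∈ L, c ∈ w) ∧ (w.map ofCode).prod = 1

/-- If s c t = 1, then t s is the inverse of c. When t s is empty, c is neutral and its own inverse.
-/
theorem IsFullRelator.inv_mem {L w : List (List (ℤ × ℤ) × ℤ)} (h : IsFullRelator L w) {x : ZWrZ}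
    (hx : x ∈ Subsemigroup.closure (generators L)) :
    x⁻¹ ∈ Subsemigroup.closure (generators L) := by
  obtain ⟨hne, hwL, hLw, hprod⟩ := h
  induction hx using Subsemigroup.closure_induction with
  | mem x hx =>
    obtain ⟨c, hc, rfl⟩ := hx
    obtain ⟨s, t, rfl⟩ := List.append_of_mem (hLw c hc)
    have hinv : (ofCode c)⁻¹ = ((t ++ s).map ofCode).prod := by
      rw [List.map_append, List.map_cons, List.prod_append, List.prod_cons] at hprod
      rw [List.map_append, List.prod_append, inv_eq_iff_mul_eq_one, ← mul_assoc]
      rwa [mul_eq_one_iff_inv_eq', inv_eq_iff_mul_eq_one] at hprod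
    by_cases hst : t ++ s = []
    · rw [hst, List.map_nil, List.prod_nil] at hinv
      rw [hinv, ← inv_one, ← hinv, inv_inv]
      exact Subsemigroup.subset_closure ⟨c, hc, rfl⟩
    · exact mem_closure_generators_iff.2 ⟨t ++ s, hst, fun d hd => hwL d (by
        rcases List.mem_append.1 hd with h | h <;> simp [h]), hinv.symm⟩
  | mul x y _ _ hx hy =>
    rw [mul_inv_rev]
    exact mul_mem hy hx

theorem semigroupIsGroup_iff {L : List (List (ℤ × ℤ) × ℤ)} :
    SemigroupIsGroup (Subsemigroup.closure (generators L)) ↔ ∃ w, IsFullRelator L w := by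
  constructor
  · rintro ⟨e, he, hinv⟩
    have he1 : (e : ZWrZ) = 1 := by
      have := congrArg Subtype.val (he e).1
      simpa using this
    obtain ⟨w₀, hw₀, hw₀L, -⟩ := mem_closure_generators_iff.1 e.2
    have hL : L ≠ [] := by
      rintro rfl
      obtain ⟨c, hc⟩ := List.exists_mem_of_ne_nil w₀ hw₀
      simpa using hw₀L c hc
    -- Multiplying the product of all generators by a word for its inverse gives a neutral word that
    -- misses none of them.
    have hx : (L.map ofCode).prod ∈ Subsemigroup.closure (generators L) :=
      mem_closure_generators_iff.2 ⟨L, hL, fun _ h => h, rfl⟩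
    obtain ⟨y, hy, -⟩ := hinv ⟨_, hx⟩
    obtain ⟨w, -, hwL, hw⟩ := mem_closure_generators_iff.1 y.2
    refine ⟨L ++ w, by simp [hL], fun c hc => ?_, fun c hc => by simp [hc], ?_⟩
    · exact (List.mem_append.1 hc).elim id (hwL c)
    · rw [List.map_append, List.prod_append, hw, ← he1, ← hy]
      rfl
  · rintro ⟨w, hw⟩
    have h1 : (1 : ZWrZ) ∈ Subsemigroup.closure (generators L) :=
      mem_closure_generators_iff.2 ⟨w, hw.1, hw.2.1, hw.2.2.2⟩
    refine ⟨⟨1, h1⟩, fun x => ⟨Subtype.ext (one_mul _), Subtype.ext (mul_one _)⟩, fun x => ?_⟩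
    exact ⟨⟨_, hw.inv_mem x.2⟩, Subtype.ext (mul_inv_cancel _), Subtype.ext (inv_mul_cancel _)⟩

/-- A neutral word is a full relator for the sublist of those generators that occur in it. -/
theorem one_mem_closure_iff {L : List (List (ℤ × ℤ) × ℤ)} :
    (1 : ZWrZ) ∈ Subsemigroup.closure (generators L) ↔
      ∃ M ∈ L.sublists', ∃ w, IsFullRelator M w := by
  rw [mem_closure_generators_iff]
  constructor
  · rintro ⟨w, hne, hL, hprod⟩
    classical
    refine ⟨L.filter (· ∈ w), List.mem_sublists'.2 List.filter_sublist, w, hne,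
      fun c hc => ?_, fun c hc => ?_, hprod⟩
    · exact List.mem_filter.2 ⟨hL c hc, by simpa using hc⟩
    · simpa using (List.mem_filter.1 hc).2
  · rintro ⟨M, hM, w, hne, hwM, -, hprod⟩
    exact ⟨w, hne, fun c hc => (List.mem_sublists'.1 hM).subset (hwM c hc), hprod⟩

/-! ### From a neutral word to a positive syzygy of the loops -/

/-- A finitely supported function as a Laurent polynomial. -/
noncomputable def laurent (y : ℤ →₀ ℤ) : LaurentPolynomial ℤ := AddMonoidAlgebra.ofCoeff y

theorem laurent_injective : Function.Injective laurent :=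
  fun _ _ h => congrArg AddMonoidAlgebra.coeff h

@[simp]
theorem laurent_zero : laurent 0 = 0 := rfl

@[simp]
theorem laurent_add (y z : ℤ →₀ ℤ) : laurent (y + z) = laurent y + laurent z := rfl

@[simp]
theorem laurent_act (k : ℤ) (y : ℤ →₀ ℤ) :
    laurent (act k y) = LaurentPolynomial.T k * laurent y := by
  induction y using Finsupp.induction_linear with
  | zero => simp [act]
  | add y z hy hz =>
    have : act k (y + z) = act k y + act k z := by ext; simp
    rw [this, laurent_add, hy, hz, laurent_add, mul_add]
  | single a b =>
    have : act k (Finsupp.single a b) = Finsupp.single (k + a) b := by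
      rw [act, Finsupp.equivMapDomain_single, Equiv.coe_addRight, add_comm]
    rw [this, LaurentPolynomial.T]
    change AddMonoidAlgebra.single _ _ = _ * AddMonoidAlgebra.single _ _
    rw [AddMonoidAlgebra.single_mul_single, one_mul]

@[simp]
theorem laurent_ofCode_fst (c : List (ℤ × ℤ) × ℤ) : laurent (ofCode c).fst = toLaurent c.1 := by
  obtain ⟨l, b⟩ := c
  induction l with
  | nil => rfl
  | cons p l ih =>
    rw [toLaurent_cons, ← ih]
    simp only [ofCode, List.map_cons, List.sum_cons, laurent_add]
    rfl

@[simp]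
theorem ofCode_snd (c : List (ℤ × ℤ) × ℤ) : (ofCode c).snd = c.2 := rfl

/-- The Laurent polynomials `y + X z` for all `(y, 1)` and `(z, -1)` in `L`. -/
def loops (L : List (List (ℤ × ℤ) × ℤ)) : List LaurentCode :=
  (L.filter fun c => c.2 = 1).flatMap fun c =>
    (L.filter fun d => d.2 = -1).map fun d => c.1 ++ shift 1 d.1

theorem mem_loops {L : List (List (ℤ × ℤ) × ℤ)} {x : LaurentCode} :
    x ∈ loops L ↔ ∃ c ∈ L, c.2 = 1 ∧ ∃ d ∈ L, d.2 = -1 ∧ c.1 ++ shift 1 d.1 = x := by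
  simp [loops, List.mem_flatMap, List.mem_map, List.mem_filter, and_assoc]

/-- The generating function of the levels at which a code is used in the walk on `ℤ` that belongs
to a word. -/
noncomputable def usage (w : List (List (ℤ × ℤ) × ℤ)) (c : List (ℤ × ℤ) × ℤ) :
    LaurentPolynomial ℤ :=
  match w with
  | [] => 0
  | x :: w => (if x = c then LaurentPolynomial.T
      ((w.map ofCode).prod.snd + if x.2 = 1 then 0 else -1) else 0) + usage w c

theorem sum_usage_cons_mul (s : Finset (List (ℤ × ℤ) × ℤ))
    (f : List (ℤ × ℤ) × ℤ → LaurentPolynomial ℤ)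
    {x : List (ℤ × ℤ) × ℤ} (hx : x ∈ s) (w : List (List (ℤ × ℤ) × ℤ)) :
    ∑ c ∈ s, usage (x :: w) c * f c = LaurentPolynomial.T
      ((w.map ofCode).prod.snd + if x.2 = 1 then 0 else -1) * f x + ∑ c ∈ s, usage w c * f c := by
  simp only [usage, add_mul, Finset.sum_add_distrib, ite_mul, zero_mul]
  rw [Finset.sum_ite_eq s x, if_pos hx]

/-- `usage` labels a letter by the lower end of the edge it crosses. A down letter starts from the
upper end, hence the extra factor X. -/
theorem sum_usage_mul_toLaurent {s : Finset (List (ℤ × ℤ) × ℤ)} (w : List (List (ℤ × ℤ) × ℤ))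
    (hw : ∀ c ∈ w, c ∈ s) :
    ∑ c ∈ s, usage w c * (LaurentPolynomial.T (if c.2 = 1 then 0 else 1) * toLaurent c.1) =
      laurent (w.map ofCode).prod.fst := by
  induction w with
  | nil => simp [usage]
  | cons x w ih =>
    rw [sum_usage_cons_mul s _ (hw x (by simp)), ih fun c hc => hw c (by simp [hc])]
    rw [List.map_cons, List.prod_cons, mul_fst, laurent_add, laurent_act, laurent_ofCode_fst,
      ← mul_assoc, ← LaurentPolynomial.T_add]
    congr 3
    split_ifs <;> ring

/-- A telescoping sum: multiplied by X - 1, each letter contributes the difference of the powers of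
X at the two heights it joins. For a word of height 0 this balances up and down crossings. -/
theorem mul_sum_usage {s : Finset (List (ℤ × ℤ) × ℤ)} (w : List (List (ℤ × ℤ) × ℤ))
    (hw : ∀ c ∈ w, c ∈ s) (hs : ∀ c ∈ w, c.2 = 1 ∨ c.2 = -1) :
    (LaurentPolynomial.T 1 - 1) * ∑ c ∈ s, usage w c * (if c.2 = 1 then 1 else -1) =
      LaurentPolynomial.T (w.map ofCode).prod.snd - 1 := by
  induction w with
  | nil => simp [usage]
  | cons x w ih =>
    rw [sum_usage_cons_mul s _ (hw x (by simp)), mul_add, ih (fun c hc => hw c (by simp [hc]))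
      fun c hc => hs c (by simp [hc]), List.map_cons, List.prod_cons, mul_snd, ofCode_snd]
    rcases hs x (by simp) with h | h
    · rw [if_pos h, if_pos h, h, add_zero, LaurentPolynomial.T_add]; ring
    · rw [if_neg (by rw [h]; decide), if_neg (by rw [h]; decide), h, LaurentPolynomial.T_add,
        LaurentPolynomial.T_add]
      have : (LaurentPolynomial.T 1 * LaurentPolynomial.T (-1) : LaurentPolynomial ℤ) = 1 := by
        rw [← LaurentPolynomial.T_add]; simp
      linear_combination (-LaurentPolynomial.T (w.map ofCode).prod.snd) * this

theorem eval₂_usage_nonneg (w : List (List (ℤ × ℤ) × ℤ)) (c : List (ℤ × ℤ) × ℤ) {x : ℝˣ}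
    (hx : 0 < (x : ℝ)) :
    0 ≤ LaurentPolynomial.eval₂ (Int.castRingHom ℝ) x (usage w c) := by
  induction w with
  | nil => simp [usage]
  | cons d w ih =>
    rw [usage, map_add]
    refine add_nonneg ?_ ih
    split_ifs
    · rw [LaurentPolynomial.eval₂_T, Units.val_zpow_eq_zpow_val]; positivity
    · rw [LaurentPolynomial.eval₂_T, Units.val_zpow_eq_zpow_val]; positivity
    · simp

theorem eval₂_usage_pos {w : List (List (ℤ × ℤ) × ℤ)} {c : List (ℤ × ℤ) × ℤ} (hc : c ∈ w) {x : ℝˣ}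
    (hx : 0 < (x : ℝ)) :
    0 < LaurentPolynomial.eval₂ (Int.castRingHom ℝ) x (usage w c) := by
  induction w with
  | nil => simp at hc
  | cons d w ih =>
    rw [usage, map_add]
    by_cases h : d = c
    · refine add_pos_of_pos_of_nonneg ?_ (eval₂_usage_nonneg w c hx)
      rw [if_pos h, LaurentPolynomial.eval₂_T, Units.val_zpow_eq_zpow_val]; positivity
    · rw [if_neg h, map_zero, zero_add]
      exact ih (by simpa [Ne.symm h] using hc)

theorem IsFullRelator.loops_ne_nil_and_not_obstructs {L w : List (List (ℤ × ℤ) × ℤ)}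
    (hL : ∀ c ∈ L, c.2 = 1 ∨ c.2 = -1) (hw : IsFullRelator L w) :
    loops L ≠ [] ∧ ∀ c : ObstructionCode, ¬c.Obstructs (loops L) := by
  obtain ⟨hne, hwL, hLw, hprod⟩ := hw
  set I := L.toFinset.filter fun c => c.2 = 1
  set J := L.toFinset.filter fun c => ¬c.2 = 1
  have hI : ∀ c, c ∈ I ↔ c ∈ L ∧ c.2 = 1 := fun c => by simp [I]
  have hJ : ∀ c, c ∈ J ↔ c ∈ L ∧ c.2 = -1 := fun c => by
    simp only [J, Finset.mem_filter, List.mem_toFinset]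
    refine and_congr_right fun hc => ⟨fun h => (hL c hc).resolve_left h, fun h => ?_⟩
    rw [h]; decide
  have hsplit : ∀ f : List (ℤ × ℤ) × ℤ → LaurentPolynomial ℤ,
      ∑ c ∈ L.toFinset, f c = ∑ c ∈ I, f c + ∑ c ∈ J, f c := fun f =>
    (Finset.sum_filter_add_sum_filter_not _ _ _).symm
  have hws : ∀ c ∈ w, c ∈ L.toFinset := fun c hc => List.mem_toFinset.2 (hwL c hc)
  have hbal : ∑ c ∈ I, usage w c = ∑ c ∈ J, usage w c := by
    have h1 := mul_sum_usage w hws fun c hc => hL c (hwL c hc)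
    rw [hprod, one_snd, LaurentPolynomial.T_zero, sub_self] at h1
    have hT : (LaurentPolynomial.T 1 - 1 : LaurentPolynomial ℤ) ≠ 0 := fun h0 => by
      have := congrArg (fun f : LaurentPolynomial ℤ => f.coeff 1) h0
      simp [← LaurentPolynomial.T_zero] at this
    have h2 := (mul_eq_zero.1 h1).resolve_left hT
    rw [hsplit, Finset.sum_congr rfl fun c hc => by rw [if_pos ((hI c).1 hc).2, mul_one],
      Finset.sum_congr (s₁ := J) rfl fun c hc => by
        rw [if_neg (by rw [((hJ c).1 hc).2]; decide), mul_neg, mul_one],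
      Finset.sum_neg_distrib, ← sub_eq_add_neg, sub_eq_zero] at h2
    exact h2
  have hrel : ∑ c ∈ I, usage w c * toLaurent c.1 +
      ∑ c ∈ J, usage w c * toLaurent (shift 1 c.1) = 0 := by
    have h1 := sum_usage_mul_toLaurent w hws
    rw [hprod, one_fst, laurent_zero, hsplit] at h1
    rw [← h1]
    congr 1
    · refine Finset.sum_congr rfl fun c hc => ?_
      rw [if_pos ((hI c).1 hc).2, LaurentPolynomial.T_zero, one_mul]
    · refine Finset.sum_congr rfl fun c hc => ?_
      rw [if_neg (by rw [((hJ c).1 hc).2]; decide), toLaurent_shift]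
  have hpos : ∀ s : Finset (List (ℤ × ℤ) × ℤ), (∀ c ∈ s, c ∈ L) → s.Nonempty →
      ∑ c ∈ s, usage w c ≠ 0 := fun s hs ⟨c, hc⟩ h0 => by
    have := congrArg (LaurentPolynomial.eval₂ (Int.castRingHom ℝ) 1) h0
    rw [map_sum, map_zero] at this
    exact (Finset.sum_pos (fun c hc => eval₂_usage_pos (hLw c (hs c hc)) (by simp))
      ⟨c, hc⟩).ne' this
  have hInonempty : I.Nonempty := by
    by_contra h
    rw [Finset.not_nonempty_iff_eq_empty] at h
    rw [h, Finset.sum_empty] at hbal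
    obtain ⟨c, hc⟩ := List.exists_mem_of_ne_nil w hne
    have hcL := hwL c hc
    rcases hL c hcL with h1 | h1
    · have := (hI c).2 ⟨hcL, h1⟩
      simp [h] at this
    · exact hpos J (fun d hd => ((hJ d).1 hd).1) ⟨c, (hJ c).2 ⟨hcL, h1⟩⟩ hbal.symm
  have hJnonempty : J.Nonempty := by
    by_contra h
    rw [Finset.not_nonempty_iff_eq_empty] at h
    rw [h, Finset.sum_empty] at hbal
    exact hpos I (fun d hd => ((hI d).1 hd).1) hInonempty hbal
  refine ⟨?_, fun o ho => ?_⟩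
  · obtain ⟨c, hc⟩ := hInonempty
    obtain ⟨d, hd⟩ := hJnonempty
    exact List.ne_nil_of_mem (mem_loops.2 ⟨c, ((hI c).1 hc).1, ((hI c).1 hc).2, d,
      ((hJ d).1 hd).1, ((hJ d).1 hd).2, rfl⟩)
  · refine ho.sum_mul_ne_zero (s := I ×ˢ J) (u := fun k => k.1.1 ++ shift 1 k.2.1)
      (h := fun k => usage w k.1 * usage w k.2) (fun k hk => ?_) (fun x hx => ?_)
      (fun k hk x hx => ?_) ?_
    · obtain ⟨h1, h2⟩ := Finset.mem_product.1 hk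
      exact mem_loops.2 ⟨k.1, ((hI _).1 h1).1, ((hI _).1 h1).2, k.2, ((hJ _).1 h2).1,
        ((hJ _).1 h2).2, rfl⟩
    · obtain ⟨c, hc, hc1, d, hd, hd1, rfl⟩ := mem_loops.1 hx
      exact ⟨(c, d), Finset.mem_product.2 ⟨(hI c).2 ⟨hc, hc1⟩, (hJ d).2 ⟨hd, hd1⟩⟩, rfl⟩
    · obtain ⟨h1, h2⟩ := Finset.mem_product.1 hk
      rw [map_mul]
      exact mul_pos (eval₂_usage_pos (hLw _ ((hI _).1 h1).1) hx)
        (eval₂_usage_pos (hLw _ ((hJ _).1 h2).1) hx)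
    · rw [Finset.sum_product]
      -- As up and down usage have the same total, the double sum is that total times the vanishing
      -- first component of the word.
      have : ∀ c d, usage w c * usage w d * toLaurent (c.1 ++ shift 1 d.1) =
          usage w c * toLaurent c.1 * usage w d +
            usage w c * (usage w d * toLaurent (shift 1 d.1)) :=
        fun c d => by rw [toLaurent_append]; ring
      simp only [this, Finset.sum_add_distrib, ← Finset.mul_sum, ← Finset.sum_mul]
      rw [hbal]
      linear_combination (∑ c ∈ J, usage w c) * hrel

end ZWrZ

/-! ### From a positive syzygy back to a neutral word -/

open Polynomial in
/-- A syzygy with natural coefficients can be chosen without gaps in the total degree. -/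
theorem exists_gapless_syzygy {K : Type*} [Fintype K] [Nonempty K] {u : K → LaurentPolynomial ℤ}
    {h : K → ℕ[X]} (h0 : ∀ k, h k ≠ 0)
    (hu : ∑ k, Polynomial.toLaurent ((h k).map (Nat.castRingHom ℤ)) * u k = 0) :
    ∃ (B : ℕ) (f : K → ℕ[X]), (∀ k, f k ≠ 0) ∧ (∀ k, (f k).natDegree ≤ B) ∧
      (∀ p ≤ B, ∃ k, (f k).coeff p ≠ 0) ∧
      ∑ k, Polynomial.toLaurent ((f k).map (Nat.castRingHom ℤ)) * u k = 0 := by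
  set H := ∑ k, h k
  have hcoeff : ∀ k p, (h k).coeff p ≤ H.coeff p := fun k p => by
    rw [finsetSum_coeff]
    exact Finset.single_le_sum (f := fun k => (h k).coeff p) (fun _ _ => Nat.zero_le _)
      (Finset.mem_univ k)
  have hdvd : ∀ k, ∃ f, h k = X ^ H.natTrailingDegree * f := fun k => by
    refine X_pow_dvd_iff.2 fun d hd => ?_
    have := hcoeff k d
    rw [coeff_eq_zero_of_lt_natTrailingDegree hd] at this
    omega
  choose f hf using hdvd
  have hf0 : ∀ k, f k ≠ 0 := fun k hk => h0 k (by rw [hf k, hk, mul_zero])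
  set F := ∑ k, f k
  have hHF : H = X ^ H.natTrailingDegree * F := by
    rw [Finset.mul_sum]
    exact Finset.sum_congr rfl fun k _ => hf k
  have hFcoeff : ∀ k p, (f k).coeff p ≤ F.coeff p := fun k p => by
    rw [finsetSum_coeff]
    exact Finset.single_le_sum (f := fun k => (f k).coeff p) (fun _ _ => Nat.zero_le _)
      (Finset.mem_univ k)
  have hF : F ≠ 0 := fun hF => by
    obtain ⟨k⟩ := ‹Nonempty K›
    refine hf0 k (Polynomial.ext fun p => ?_)
    have := hFcoeff k p
    rw [hF, coeff_zero] at this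
    rw [coeff_zero]; omega
  have hH : H ≠ 0 := by
    rw [hHF]; exact mul_ne_zero (pow_ne_zero _ X_ne_zero) hF
  have hF0 : F.coeff 0 ≠ 0 := by
    have h1 : H.coeff H.natTrailingDegree ≠ 0 := by
      rw [← trailingCoeff]; exact trailingCoeff_nonzero_iff_nonzero.2 hH
    have h2 : H.coeff H.natTrailingDegree = F.coeff 0 := by
      conv_lhs => rw [hHF]
      rw [← coeff_X_pow_mul F H.natTrailingDegree 0, zero_add, ← hHF]
    rwa [h2] at h1
  set M := F.natDegree
  set G : ℕ[X] := ∑ i ∈ Finset.range (M + 1), X ^ i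
  have hGcoeff : ∀ p, G.coeff p = if p ≤ M then 1 else 0 := fun p => by
    simp [G, finsetSum_coeff, coeff_X_pow]
  have hG : G ≠ 0 := fun h => by
    have := hGcoeff 0
    rw [h] at this; simp at this
  have hGdeg : G.natDegree ≤ M := natDegree_le_iff_coeff_eq_zero.2 fun p hp => by
    rw [hGcoeff, if_neg (by omega)]
  have hfdeg : ∀ k, (f k).natDegree ≤ M := fun k => natDegree_le_iff_coeff_eq_zero.2 fun p hp => by
    have := hFcoeff k p
    rw [coeff_eq_zero_of_natDegree_lt hp] at this
    omega
  -- Degrees up to M are reached by the constant coefficient of `F`, larger ones by its leading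
  -- coefficient; natural coefficients cannot cancel.
  refine ⟨M + M, fun k => f k * G, fun k => mul_ne_zero (hf0 k) hG,
    fun k => natDegree_mul_le.trans (add_le_add (hfdeg k) hGdeg), fun p hp => ?_, ?_⟩
  · by_contra! hz
    have h1 : (F * G).coeff p = 0 := by
      rw [Finset.sum_mul, finsetSum_coeff]
      exact Finset.sum_eq_zero fun k _ => hz k
    rw [coeff_mul, Finset.sum_eq_zero_iff] at h1
    by_cases hpM : p ≤ M
    · have := h1 (0, p) (by simp)
      rw [hGcoeff, if_pos hpM, mul_one] at this
      exact hF0 this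
    · have := h1 (M, p - M) (by simp; omega)
      rw [hGcoeff, if_pos (by simp; omega), mul_one] at this
      exact hF (leadingCoeff_eq_zero.1 this)
  · have hT : (Polynomial.toLaurent ((X ^ H.natTrailingDegree : ℕ[X]).map (Nat.castRingHom ℤ))) *
        ∑ k, Polynomial.toLaurent ((f k).map (Nat.castRingHom ℤ)) * u k = 0 := by
      rw [← hu, Finset.mul_sum]
      refine Finset.sum_congr rfl fun k _ => ?_
      rw [hf k, Polynomial.map_mul, map_mul, mul_assoc]
    rw [Polynomial.map_pow, map_X, Polynomial.toLaurent_X_pow] at hT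
    have h2 := (LaurentPolynomial.isUnit_T (R := ℤ) _).mul_right_eq_zero.1 hT
    rw [← zero_mul (Polynomial.toLaurent (G.map (Nat.castRingHom ℤ))), ← h2, Finset.sum_mul]
    refine Finset.sum_congr rfl fun k _ => ?_
    rw [Polynomial.map_mul, map_mul]; ring

namespace ZWrZ

open LaurentCode

/-- A word over `L` that multiplies to `(x, 0)` and contains both codes of every pair in `A`. -/
def IsLoop {K : Type*} (L : List (List (ℤ × ℤ) × ℤ)) (up down : K → List (ℤ × ℤ) × ℤ)
    (x : LaurentPolynomial ℤ) (A : Set K) : Prop :=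
  ∃ w : List (List (ℤ × ℤ) × ℤ), (∀ c ∈ w, c ∈ L) ∧ (∀ k ∈ A, up k ∈ w ∧ down k ∈ w) ∧
    laurent (w.map ofCode).prod.fst = x ∧ (w.map ofCode).prod.snd = 0

section

variable {K : Type*} {L : List (List (ℤ × ℤ) × ℤ)} {up down : K → List (ℤ × ℤ) × ℤ}

theorem IsLoop.congr {x y : LaurentPolynomial ℤ} {A B : Set K} (h : IsLoop L up down x A)
    (hxy : x = y) (hBA : B ⊆ A) : IsLoop L up down y B := by
  obtain ⟨w, h1, h2, h3, h4⟩ := h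
  exact ⟨w, h1, fun k hk => h2 k (hBA hk), hxy ▸ h3, h4⟩

theorem IsLoop.add {x y : LaurentPolynomial ℤ} {A B : Set K} (hx : IsLoop L up down x A)
    (hy : IsLoop L up down y B) : IsLoop L up down (x + y) (A ∪ B) := by
  obtain ⟨w, h1, h2, rfl, h4⟩ := hx
  obtain ⟨w', h1', h2', rfl, h4'⟩ := hy
  refine ⟨w ++ w', fun c hc => (List.mem_append.1 hc).elim (h1 c) (h1' c), fun k hk => ?_, ?_, ?_⟩
  · rcases hk with hk | hk
    · simp [h2 k hk]
    · simp [h2' k hk]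
  · rw [List.map_append, List.prod_append, mul_fst, h4', laurent_add, laurent_act,
      LaurentPolynomial.T_zero, one_mul]
  · rw [List.map_append, List.prod_append, mul_snd, h4, h4', add_zero]

variable (hup : ∀ k, up k ∈ L ∧ (up k).2 = 1) (hdown : ∀ k, down k ∈ L ∧ (down k).2 = -1)
include hup hdown

/-- Letters are shifted by the height to their right, so a final up letter raises everything before
it by one level and the initial down letter returns to height 0. -/
theorem IsLoop.nest {x : LaurentPolynomial ℤ} {A : Set K} (hx : IsLoop L up down x A) (k : K) :
    IsLoop L up down (LaurentPolynomial.T 1 * x + toLaurent ((up k).1 ++ shift 1 (down k).1))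
      (insert k A) := by
  obtain ⟨w, h1, h2, rfl, h4⟩ := hx
  refine ⟨down k :: (w ++ [up k]), fun c hc => ?_, fun j hj => ?_, ?_, ?_⟩
  · simp only [List.mem_cons, List.mem_append, List.not_mem_nil, or_false] at hc
    rcases hc with rfl | hc | rfl
    exacts [(hdown k).1, h1 c hc, (hup k).1]
  · rcases hj with rfl | hj
    · simp
    · simp [h2 j hj]
  · simp only [List.map_cons, List.map_append, List.map_nil, List.prod_cons, List.prod_append,
      List.prod_nil, mul_one, mul_fst, mul_snd, laurent_add, laurent_act, laurent_ofCode_fst,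
      ofCode_snd, h4, (hup k).2, zero_add, toLaurent_append, toLaurent_shift]
    ring
  · simp only [List.map_cons, List.map_append, List.map_nil, List.prod_cons, List.prod_append,
      List.prod_nil, mul_one, mul_snd, ofCode_snd, h4, (hup k).2, (hdown k).2]
    norm_num

theorem isLoop_single (k : K) :
    IsLoop L up down (toLaurent ((up k).1 ++ shift 1 (down k).1)) {k} := by
  have : IsLoop L up down 0 (∅ : Set K) := ⟨[], by simp, by simp, by simp, by simp⟩
  exact (this.nest hup hdown k).congr (by simp) (by simp)

theorem IsLoop.add_multiset {x : LaurentPolynomial ℤ} {A : Set K} (hx : IsLoop L up down x A)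
    (m : Multiset K) :
    IsLoop L up down (x + (m.map fun k => toLaurent ((up k).1 ++ shift 1 (down k).1)).sum)
      (A ∪ {k | k ∈ m}) := by
  induction m using Multiset.induction_on with
  | empty => exact hx.congr (by simp) (by simp)
  | cons k m ih =>
    refine (ih.add (isLoop_single hup hdown k)).congr ?_ ?_
    · rw [Multiset.map_cons, Multiset.sum_cons]; ring
    · rintro j (hj | hj)
      · exact Or.inl (Or.inl hj)
      · rcases Multiset.mem_cons.1 hj with rfl | hj
        · exact Or.inr rfl
        · exact Or.inl (Or.inr hj)

open Polynomial in
-- Horner's scheme for words: the loops of higher level are nested inside one loop of level 0, and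
-- the other loops of level 0 are appended. Gaplessness supplies the enclosing loop at each level.
theorem isLoop_of_gapless [Fintype K] (B : ℕ) : ∀ f : K → ℕ[X], (∀ k, (f k).natDegree ≤ B) →
    (∀ p ≤ B, ∃ k, (f k).coeff p ≠ 0) →
    IsLoop L up down (∑ k, Polynomial.toLaurent ((f k).map (Nat.castRingHom ℤ)) *
      toLaurent ((up k).1 ++ shift 1 (down k).1)) {k | f k ≠ 0} := by
  set u : K → LaurentPolynomial ℤ := fun k => toLaurent ((up k).1 ++ shift 1 (down k).1)
  have hlevel : ∀ a : K → ℕ, (∃ k, a k ≠ 0) → ∃ (k : K) (m : Multiset K),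
      (∑ j, (a j : LaurentPolynomial ℤ) * u j = u k + (m.map u).sum) ∧
      ∀ j, a j ≠ 0 → j = k ∨ j ∈ m := fun a ⟨k, hk⟩ => by
    set m : Multiset K := ∑ j, Multiset.replicate (a j) j
    have hmem : ∀ j, a j ≠ 0 → j ∈ m := fun j hj =>
      Multiset.mem_sum.2 ⟨j, Finset.mem_univ j, Multiset.mem_replicate.2 ⟨hj, rfl⟩⟩
    obtain ⟨m', hm'⟩ := Multiset.exists_cons_of_mem (hmem k hk)
    refine ⟨k, m', ?_, fun j hj => ?_⟩
    · rw [← Multiset.sum_cons, ← Multiset.map_cons, ← hm']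
      have : (m.map u).sum = ∑ j, ((Multiset.replicate (a j) j).map u).sum := by
        change ((Multiset.sumAddMonoidHom).comp (Multiset.mapAddMonoidHom u)) m = _
        rw [map_sum]
        rfl
      rw [this]
      simp
    · exact Multiset.mem_cons.1 (hm' ▸ hmem j hj)
  induction B with
  | zero =>
    intro f hdeg hgap
    obtain ⟨k, m, h1, h2⟩ := hlevel (fun k => (f k).coeff 0) (hgap 0 le_rfl)
    have hC : ∀ k, f k = C ((f k).coeff 0) := fun k =>
      eq_C_of_natDegree_eq_zero (Nat.le_zero.1 (hdeg k))
    refine ((isLoop_single hup hdown k).add_multiset hup hdown m).congr ?_ fun j hj => ?_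
    · rw [← h1]
      refine Finset.sum_congr rfl fun k _ => ?_
      conv_rhs => rw [hC k]
      simp [u]
    · exact h2 j fun h0 => hj (by rw [hC j, h0, C_0])
  | succ B ih =>
    intro f hdeg hgap
    obtain ⟨k, m, h1, h2⟩ := hlevel (fun k => (f k).coeff 0) (hgap 0 (Nat.zero_le _))
    have hIH := ih (fun k => (f k).divX) (fun k => by
      rw [natDegree_divX_eq_natDegree_tsub_one]; have := hdeg k; omega) fun p hp => by
        obtain ⟨j, hj⟩ := hgap (p + 1) (by omega)
        exact ⟨j, by rwa [coeff_divX]⟩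
    refine ((hIH.nest hup hdown k).add_multiset hup hdown m).congr ?_ fun j hj => ?_
    · rw [add_assoc, ← h1, Finset.mul_sum, ← Finset.sum_add_distrib]
      refine Finset.sum_congr rfl fun k _ => ?_
      conv_rhs => rw [← divX_mul_X_add (f k)]
      simp only [Polynomial.map_add, Polynomial.map_mul, map_X, map_C, map_add, map_mul,
        Polynomial.toLaurent_X, Polynomial.toLaurent_C, u]
      simp
      ring
    · by_cases h0 : (f j).coeff 0 = 0
      · refine Or.inl (Or.inr fun hz => hj ?_)
        rw [← divX_mul_X_add (f j), hz, h0]; simp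
      · rcases h2 j h0 with rfl | h3
        · exact Or.inl (Or.inl rfl)
        · exact Or.inr h3

end

theorem exists_isFullRelator_iff {L : List (List (ℤ × ℤ) × ℤ)}
    (hL : ∀ c ∈ L, c.2 = 1 ∨ c.2 = -1) :
    (∃ w, IsFullRelator L w) ↔
      loops L ≠ [] ∧ ∀ c : ObstructionCode, ¬c.Obstructs (loops L) := by
  refine ⟨fun ⟨w, hw⟩ => hw.loops_ne_nil_and_not_obstructs hL, fun ⟨hne, hno⟩ => ?_⟩
  let K := {c // c ∈ L.toFinset.filter fun c => c.2 = 1} ×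
    {c // c ∈ L.toFinset.filter fun c => c.2 = -1}
  let up : K → List (ℤ × ℤ) × ℤ := fun k => k.1.1
  let down : K → List (ℤ × ℤ) × ℤ := fun k => k.2.1
  have hup : ∀ k, up k ∈ L ∧ (up k).2 = 1 := fun k => by
    have := Finset.mem_filter.1 k.1.2
    exact ⟨List.mem_toFinset.1 this.1, this.2⟩
  have hdown : ∀ k, down k ∈ L ∧ (down k).2 = -1 := fun k => by
    have := Finset.mem_filter.1 k.2.2
    exact ⟨List.mem_toFinset.1 this.1, this.2⟩
  have hpair : ∀ c ∈ L, c.2 = 1 → ∀ d ∈ L, d.2 = -1 → ∃ k, up k = c ∧ down k = d :=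
    fun c hc hc1 d hd hd1 => ⟨⟨⟨c, by simp [hc, hc1]⟩, ⟨d, by simp [hd, hd1]⟩⟩, rfl, rfl⟩
  have hU : ∀ x, x ∈ loops L ↔ ∃ k, (up k).1 ++ shift 1 (down k).1 = x := fun x => by
    rw [mem_loops]
    constructor
    · rintro ⟨c, hc, hc1, d, hd, hd1, rfl⟩
      obtain ⟨k, rfl, rfl⟩ := hpair c hc hc1 d hd hd1
      exact ⟨k, rfl⟩
    · rintro ⟨k, rfl⟩
      exact ⟨up k, (hup k).1, (hup k).2, down k, (hdown k).1, (hdown k).2, rfl⟩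
  obtain ⟨x, hx⟩ := List.exists_mem_of_ne_nil _ hne
  obtain ⟨k₀, -⟩ := (hU x).1 hx
  have : Nonempty K := ⟨k₀⟩
  have hsyz := mt (ObstructionCode.exists_obstructs hU) fun ⟨c, hc⟩ => hno c hc
  rw [not_not] at hsyz
  obtain ⟨h, h0, hs⟩ := hsyz
  obtain ⟨B, f, hf0, hdeg, hgap, hfs⟩ := exists_gapless_syzygy h0 hs
  obtain ⟨w, hwL, hmem, hfst, hsnd⟩ := isLoop_of_gapless hup hdown B f hdeg hgap
  -- Nonemptiness of `loops L` provides letters of both directions, so each generator belongs to a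
  -- pair and occurs in the word.
  refine ⟨w, List.ne_nil_of_mem (hmem k₀ (hf0 k₀)).1, hwL, fun c hc => ?_, ?_⟩
  · rcases hL c hc with h1 | h1
    · obtain ⟨k, hk, -⟩ := hpair c hc h1 _ (hdown k₀).1 (hdown k₀).2
      exact hk ▸ (hmem k (hf0 k)).1
    · obtain ⟨k, -, hk⟩ := hpair _ (hup k₀).1 (hup k₀).2 c hc h1
      exact hk ▸ (hmem k (hf0 k)).2
  · exact ZWrZ.ext (laurent_injective (hfst.trans hfs)) hsnd

end ZWrZ

/-! ### Primitive recursive arithmetic and semidecidability -/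

namespace Primrec

variable {α β : Type*} [Primcodable α] [Primcodable β]

theorem encode_int_natCast (n : ℕ) : Encodable.encode (n : ℤ) = 2 * n := rfl

theorem encode_int_negSucc (n : ℕ) : Encodable.encode (Int.negSucc n) = 2 * n + 1 := rfl

theorem int_toNat : Primrec Int.toNat :=
  (ite (Primrec.eq.comp (nat_mod.comp Primrec.encode (const 2)) (const 0))
    (nat_div.comp Primrec.encode (const 2)) (const 0)).of_eq fun z => by
      rcases z with n | n
      · change (if (2 * n) % 2 = 0 then 2 * n / 2 else 0) = n
        rw [if_pos (by omega)]; omega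
      · change (if (2 * n + 1) % 2 = 0 then (2 * n + 1) / 2 else 0) = 0
        rw [if_neg (by omega)]

theorem int_toNat_neg : Primrec fun z : ℤ => (-z).toNat :=
  (ite (Primrec.eq.comp (nat_mod.comp Primrec.encode (const 2)) (const 0)) (const 0)
    (succ.comp (nat_div.comp Primrec.encode (const 2)))).of_eq fun z => by
      rcases z with n | n
      · change (if (2 * n) % 2 = 0 then 0 else (2 * n / 2).succ) = (-(n : ℤ)).toNat
        rw [if_pos (by omega)]; omega
      · change (if (2 * n + 1) % 2 = 0 then 0 else ((2 * n + 1) / 2).succ) =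
          (-(Int.negSucc n)).toNat
        rw [if_neg (by omega)]; omega

/-- The other integer operations are assembled from this one and from positive and negative parts,
without opening the encoding of ℤ again. -/
theorem int_sub_natCast : Primrec₂ fun m n : ℕ => (m : ℤ) - n :=
  encode_iff.1 <| (ite (nat_le.comp snd fst)
    (nat_mul.comp (const 2) (nat_sub.comp fst snd))
    (succ.comp (nat_mul.comp (const 2) (pred.comp (nat_sub.comp snd fst))))).of_eq
      fun ⟨m, n⟩ => by
        dsimp only
        split_ifs with h
        · rw [← Nat.cast_sub h, encode_int_natCast]
        · obtain ⟨k, rfl⟩ : ∃ k, n = m + k + 1 := ⟨n - m - 1, by omega⟩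
          have : (m : ℤ) - (m + k + 1 : ℕ) = Int.negSucc k := by omega
          rw [this, encode_int_negSucc, Nat.pred_eq_sub_one, Nat.succ_eq_add_one,
            show m + k + 1 - m - 1 = k by omega]

theorem int_natCast : Primrec fun n : ℕ => (n : ℤ) :=
  (int_sub_natCast.comp Primrec.id (const 0)).of_eq fun n => by simp

theorem int_neg : Primrec fun z : ℤ => -z :=
  (int_sub_natCast.comp int_toNat_neg int_toNat).of_eq fun z => by omega

theorem int_add : Primrec₂ fun a b : ℤ => a + b :=
  (int_sub_natCast.comp (nat_add.comp (int_toNat.comp fst) (int_toNat.comp snd))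
    (nat_add.comp (int_toNat_neg.comp fst) (int_toNat_neg.comp snd))).of_eq fun _ => by
      push_cast; omega

theorem int_sub : Primrec₂ fun a b : ℤ => a - b :=
  (int_add.comp fst (int_neg.comp snd)).of_eq fun p => (sub_eq_add_neg p.1 p.2).symm

theorem int_mul : Primrec₂ fun a b : ℤ => a * b :=
  (int_sub_natCast.comp
    (nat_add.comp (nat_mul.comp (int_toNat.comp fst) (int_toNat.comp snd))
      (nat_mul.comp (int_toNat_neg.comp fst) (int_toNat_neg.comp snd)))
    (nat_add.comp (nat_mul.comp (int_toNat.comp fst) (int_toNat_neg.comp snd))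
      (nat_mul.comp (int_toNat_neg.comp fst) (int_toNat.comp snd)))).of_eq fun p => by
      have h1 : p.1 = p.1.toNat - (-p.1).toNat := by omega
      have h2 : p.2 = p.2.toNat - (-p.2).toNat := by omega
      conv_rhs => rw [h1, h2]
      push_cast; ring

theorem int_le : PrimrecRel fun a b : ℤ => a ≤ b :=
  (nat_le.comp (nat_add.comp (int_toNat.comp fst) (int_toNat_neg.comp snd))
    (nat_add.comp (int_toNat.comp snd) (int_toNat_neg.comp fst))).of_eq fun _ => by omega

theorem int_lt : PrimrecRel fun a b : ℤ => a < b :=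
  (PrimrecPred.not (int_le.comp snd fst)).of_eq fun _ => not_le

theorem int_natAbs : Primrec Int.natAbs :=
  (nat_add.comp int_toNat int_toNat_neg).of_eq fun z => by omega

theorem int_min : Primrec₂ fun a b : ℤ => min a b :=
  (ite (int_le.comp fst snd) fst snd).of_eq fun p => (min_def p.1 p.2).symm

theorem nat_pow : Primrec₂ fun a b : ℕ => a ^ b :=
  Primrec₂.unpaired'.1 Nat.Primrec.pow

theorem list_sum_map_int {f : α → List β} {g : α → β → ℤ} (hf : Primrec f) (hg : Primrec₂ g) :
    Primrec fun a => ((f a).map (g a)).sum :=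
  (list_foldr (list_map hf hg) (const 0)
    ((int_add.comp (fst.comp snd) (snd.comp snd)).to₂)).of_eq fun a => by rfl

theorem list_sum_map_nat {f : α → List β} {g : α → β → ℕ} (hf : Primrec f) (hg : Primrec₂ g) :
    Primrec fun a => ((f a).map (g a)).sum :=
  (list_foldr (list_map hf hg) (const 0)
    ((nat_add.comp (fst.comp snd) (snd.comp snd)).to₂)).of_eq fun a => by rfl

theorem list_sublists' : Primrec (List.sublists' : List α → List (List α)) :=
  (list_foldr (f := id) (g := fun _ => [[]]) (h := fun _ p => p.2 ++ p.2.map (List.cons p.1))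
    Primrec.id (const _) (list_append.comp (snd.comp snd) (list_map (snd.comp snd)
      (list_cons.comp (fst.comp (snd.comp fst)) snd).to₂)).to₂).of_eq fun l => by
      induction l with
      | nil => rfl
      | cons a l ih => rw [List.sublists'_cons, ← ih]; rfl

end Primrec

section

variable {α β : Type*} [Primcodable α] [Primcodable β]

theorem PrimrecPred.exists_mem_list_comp {f : α → List β} {p : α → β → Prop} (hf : Primrec f)
    (hp : PrimrecRel p) : PrimrecPred fun a => ∃ b ∈ f a, p a b :=
  hp.swap.exists_mem_list.comp hf Primrec.id

theorem PrimrecPred.forall_mem_list_comp {f : α → List β} {p : α → β → Prop} (hf : Primrec f)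
    (hp : PrimrecRel p) : PrimrecPred fun a => ∀ b ∈ f a, p a b :=
  hp.swap.forall_mem_list.comp hf Primrec.id

theorem REPred.exists_of_primrec {p : α → β → Prop} (hp : PrimrecRel p) :
    REPred fun a => ∃ b, p a b := by
  classical
  have h : Computable₂ fun (a : α) (n : ℕ) =>
      (Encodable.decode (α := β) n).bind fun b => Option.guard (p a) b := by
    refine Primrec₂.to_comp ?_
    exact Primrec.option_bind (Primrec.decode.comp Primrec.snd)
      (Primrec.option_guard (p := fun (x : (α × ℕ) × β) (b : β) => p x.1.1 b)
        (hp.comp (Primrec.fst.comp (Primrec.fst.comp Primrec.fst)) Primrec.snd) Primrec.snd).to₂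
  refine (Partrec.rfindOpt h).dom_re.of_eq fun a => ?_
  rw [Nat.rfindOpt_dom]
  constructor
  · rintro ⟨n, b, hb⟩
    obtain ⟨b', -, hb'⟩ := Option.bind_eq_some_iff.1 hb
    exact ⟨b', by simpa [Option.guard] using (Option.guard_eq_some_iff.1 hb').2⟩
  · rintro ⟨b, hb⟩
    exact ⟨Encodable.encode b, b, by simp [Option.guard, hb]⟩

/-- Post's theorem applied to D ∧ P. As the complement contains all inputs outside D, these need
some witness too, and `c₀` supplies it. -/
theorem DecidableProblem.of_primrec {γ : Type*} [Primcodable γ] {D P : α → Prop}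
    {y : α → β → Prop} {n : α → γ → Prop} (hD : PrimrecPred D) (hy : PrimrecRel y)
    (hn : PrimrecRel n) (hP : ∀ a, D a → (P a ↔ ∃ b, y a b))
    (hP' : ∀ a, D a → (¬P a ↔ ∃ c, n a c)) (c₀ : γ) : DecidableProblem D P := by
  have h : ComputablePred fun a => D a ∧ P a := by
    rw [ComputablePred.computable_iff_re_compl_re']
    constructor
    · refine (REPred.exists_of_primrec (p := fun a b => D a ∧ y a b)
        (PrimrecPred.and (hD.comp Primrec.fst) hy)).of_eq fun a => ?_
      rw [exists_and_left]
      exact and_congr_right fun ha => (hP a ha).symm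
    · refine (REPred.exists_of_primrec (p := fun a c => ¬D a ∨ n a c)
        (PrimrecPred.or (PrimrecPred.not (hD.comp Primrec.fst)) hn)).of_eq fun a => ?_
      by_cases ha : D a
      · simp [ha, hP' a ha]
      · exact iff_of_true ⟨c₀, Or.inl ha⟩ fun h => ha h.1
  obtain ⟨f, hf, hfP⟩ := ComputablePred.computable_iff.1 h
  refine ⟨f, hf, fun a ha => ?_⟩
  have := congrFun hfP a
  simp only [ha, true_and] at this
  exact Iff.of_eq this.symm

end

/-! ### Primitive recursive verification of certificates -/

namespace LaurentCode

open Primrec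

theorem primrec_mul : Primrec₂ mul :=
  (list_flatMap fst (list_map (snd.comp fst) (Primrec.pair
    (int_add.comp (fst.comp (snd.comp fst)) (fst.comp snd))
    (int_mul.comp (snd.comp (snd.comp fst)) (snd.comp snd))).to₂).to₂).to₂

theorem primrec_neg : Primrec neg :=
  list_map Primrec.id (Primrec.pair (fst.comp snd) (int_neg.comp (snd.comp snd))).to₂

theorem primrec_shift : Primrec₂ shift :=
  list_map snd (Primrec.pair (int_add.comp (fst.comp snd) (fst.comp fst)) (snd.comp snd)).to₂

theorem primrec_coeffAt : Primrec₂ coeffAt :=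
  list_sum_map_int fst (ite (Primrec.eq.comp (fst.comp snd) (snd.comp fst)) (snd.comp snd)
    (const 0)).to₂

theorem primrec_isZero : PrimrecPred IsZero :=
  PrimrecPred.forall_mem_list_comp Primrec.id
    (Primrec.eq.comp (primrec_coeffAt.comp fst (fst.comp snd)) (const 0))

theorem primrec_height : Primrec height :=
  list_sum_map_nat Primrec.id (int_natAbs.comp (fst.comp snd)).to₂

theorem primrec_scaledTerm {α : Type*} [Primcodable α] {N a b q : α → ℕ} {p : α → ℤ × ℤ}
    (hN : Primrec N) (ha : Primrec a) (hb : Primrec b) (hq : Primrec q) (hp : Primrec p) :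
    Primrec fun x => scaledTerm (N x) (a x) (b x) (q x) (p x) :=
  int_mul.comp (snd.comp hp) (int_natCast.comp (nat_mul.comp (nat_mul.comp (nat_pow.comp hb hN)
    (nat_pow.comp ha (int_toNat.comp (int_add.comp (int_natCast.comp hN) (fst.comp hp)))))
    (nat_pow.comp hq (int_toNat.comp (int_sub.comp (int_natCast.comp hN) (fst.comp hp))))))

theorem primrec_scaledEval {α : Type*} [Primcodable α] {l : α → LaurentCode} {a b q : α → ℕ}
    (hl : Primrec l) (ha : Primrec a) (hb : Primrec b) (hq : Primrec q) :
    Primrec fun x => scaledEval (l x) (a x) (b x) (q x) :=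
  list_sum_map_int hl (primrec_scaledTerm (primrec_height.comp (hl.comp fst)) (ha.comp fst)
    (hb.comp fst) (hq.comp fst) snd).to₂

theorem primrec_scaledLower {α : Type*} [Primcodable α] {l : α → LaurentCode} {a b q : α → ℕ}
    (hl : Primrec l) (ha : Primrec a) (hb : Primrec b) (hq : Primrec q) :
    Primrec fun x => scaledLower (l x) (a x) (b x) (q x) :=
  list_sum_map_int hl (int_min.comp
    (primrec_scaledTerm (primrec_height.comp (hl.comp fst)) (ha.comp fst)
      (hb.comp fst) (hq.comp fst) snd)
    (primrec_scaledTerm (primrec_height.comp (hl.comp fst)) (hb.comp fst)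
      (ha.comp fst) (hq.comp fst) snd)).to₂

end LaurentCode

namespace ObstructionCode

open Primrec LaurentCode

theorem primrec_matches {α : Type*} [Primcodable α] {c : α → ObstructionCode}
    {e : α → Bool × LaurentCode} {u : α → LaurentCode} (hc : Primrec c) (he : Primrec e)
    (hu : Primrec u) : PrimrecPred fun x => Matches (c x) (e x) (u x) := by
  have hentry : Primrec fun x => entry (c x) (e x) :=
    ite (Primrec.eq.comp (fst.comp he) (const true))
      (primrec_mul.comp (fst.comp (snd.comp (snd.comp hc))) (snd.comp he)) (snd.comp he)
  exact primrec_isZero.comp (list_append.comp (primrec_mul.comp (fst.comp hc) hu)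
    (primrec_neg.comp (primrec_mul.comp (fst.comp (snd.comp hc)) hentry)))

theorem primrec_obstructs : PrimrecRel Obstructs := by
  have hD : Primrec fun x : ObstructionCode × List LaurentCode => x.1.2.1 :=
    fst.comp (snd.comp fst)
  have hg : Primrec fun x : ObstructionCode × List LaurentCode => x.1.2.2.1 :=
    fst.comp (snd.comp (snd.comp fst))
  have hr : Primrec fun x : ObstructionCode × List LaurentCode => x.1.2.2.2 :=
    snd.comp (snd.comp (snd.comp fst))
  have ha : Primrec fun x : ObstructionCode × List LaurentCode => x.1.2.2.2.1.1 :=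
    fst.comp (fst.comp hr)
  have hb : Primrec fun x : ObstructionCode × List LaurentCode => x.1.2.2.2.1.2.1 :=
    fst.comp (snd.comp (fst.comp hr))
  have hq : Primrec fun x : ObstructionCode × List LaurentCode => x.1.2.2.2.1.2.2 :=
    snd.comp (snd.comp (fst.comp hr))
  have hE : Primrec fun x : ObstructionCode × List LaurentCode => x.1.2.2.2.2 := snd.comp hr
  have hm : PrimrecRel fun (x : (ObstructionCode × List LaurentCode) × LaurentCode)
      (e : Bool × LaurentCode) => Matches x.1.1 e x.2 :=
    primrec_matches (fst.comp (fst.comp fst)) snd (snd.comp fst)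
  have hu : Primrec fun x : (ObstructionCode × List LaurentCode) × LaurentCode =>
      x.1.1.2.2.2.2 := hE.comp fst
  refine PrimrecPred.and (PrimrecPred.and (PrimrecPred.and ?_ (PrimrecPred.and ?_ ?_))
    (PrimrecPred.and ?_ (PrimrecPred.and ?_ ?_))) (PrimrecPred.and ?_ (PrimrecPred.and ?_ ?_))
  · exact nat_lt.comp (const 0) ha
  · exact nat_lt.comp (const 0) hb
  · exact nat_lt.comp (const 0) hq
  · exact PrimrecPred.not (primrec_isZero.comp hD)
  · exact int_lt.comp (primrec_scaledEval hg ha hb hq) (const 0)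
  · exact int_lt.comp (const 0) (primrec_scaledEval hg hb ha hq)
  · exact PrimrecPred.forall_mem_list_comp hE (PrimrecPred.or
      (Primrec.eq.comp (fst.comp snd) (const true))
      (int_lt.comp (const 0) (primrec_scaledLower (snd.comp snd) (ha.comp fst) (hb.comp fst)
        (hq.comp fst))))
  · exact PrimrecPred.forall_mem_list_comp snd (PrimrecPred.exists_mem_list_comp hu hm)
  · exact PrimrecPred.exists_mem_list_comp snd (PrimrecPred.exists_mem_list_comp hu
      (PrimrecPred.and (Primrec.eq.comp (fst.comp snd) (const false)) hm))

end ObstructionCode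

namespace ZWrZ

open Primrec LaurentCode

/-- The code of the product of the elements that are written down in a word. -/
def prodCode (w : List (List (ℤ × ℤ) × ℤ)) : List (ℤ × ℤ) × ℤ :=
  w.foldr (fun c d => (shift d.2 c.1 ++ d.1, c.2 + d.2)) ([], 0)

theorem laurent_prod_fst (w : List (List (ℤ × ℤ) × ℤ)) :
    laurent (w.map ofCode).prod.fst = toLaurent (prodCode w).1 ∧
      (w.map ofCode).prod.snd = (prodCode w).2 := by
  induction w with
  | nil => exact ⟨rfl, rfl⟩
  | cons c w ih =>
    have h : prodCode (c :: w) = (shift (prodCode w).2 c.1 ++ (prodCode w).1,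
      c.2 + (prodCode w).2) := rfl
    rw [List.map_cons, List.prod_cons, mul_fst, mul_snd, laurent_add, laurent_act,
      laurent_ofCode_fst, ofCode_snd, ih.1, ih.2, h, toLaurent_append, toLaurent_shift]
    exact ⟨rfl, rfl⟩

theorem prod_map_ofCode_eq_one_iff (w : List (List (ℤ × ℤ) × ℤ)) :
    (w.map ofCode).prod = 1 ↔ IsZero (prodCode w).1 ∧ (prodCode w).2 = 0 := by
  rw [isZero_iff, ← (laurent_prod_fst w).1, ← (laurent_prod_fst w).2, ZWrZ.ext_iff, one_fst,
    one_snd]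
  refine and_congr_left fun _ => ⟨fun h => by rw [h, laurent_zero], fun h => ?_⟩
  exact laurent_injective (h.trans laurent_zero.symm)

theorem primrec_isFullRelator : PrimrecRel IsFullRelator := by
  have hp : Primrec prodCode :=
    list_foldr (f := id) (g := fun _ => ([], 0))
      (h := fun _ (p : (List (ℤ × ℤ) × ℤ) × List (ℤ × ℤ) × ℤ) =>
        (shift p.2.2 p.1.1 ++ p.2.1, p.1.2 + p.2.2))
      Primrec.id (const _) (Primrec.pair
      (list_append.comp (primrec_shift.comp (Primrec.snd.comp (Primrec.snd.comp Primrec.snd))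
        (Primrec.fst.comp (Primrec.fst.comp Primrec.snd)))
        (Primrec.fst.comp (Primrec.snd.comp Primrec.snd)))
      (int_add.comp (Primrec.snd.comp (Primrec.fst.comp Primrec.snd))
        (Primrec.snd.comp (Primrec.snd.comp Primrec.snd)))).to₂
  have hsub : ∀ {f g : List (List (ℤ × ℤ) × ℤ) × List (List (ℤ × ℤ) × ℤ) →
      List (List (ℤ × ℤ) × ℤ)}, Primrec f → Primrec g →
      PrimrecPred fun x => ∀ c ∈ f x, c ∈ g x := fun {f g} hf hg => by
    refine PrimrecPred.forall_mem_list_comp hf ?_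
    refine (PrimrecPred.exists_mem_list_comp
      (p := fun (x : (List (List (ℤ × ℤ) × ℤ) × List (List (ℤ × ℤ) × ℤ)) × List (ℤ × ℤ) × ℤ)
        (d : List (ℤ × ℤ) × ℤ) => d = x.2) (hg.comp Primrec.fst)
      (Primrec.eq.comp Primrec.snd (Primrec.snd.comp Primrec.fst))).of_eq fun x => ?_
    exact exists_eq_right
  refine PrimrecPred.and (PrimrecPred.not (Primrec.eq.comp Primrec.snd (const []))) (PrimrecPred.and
    (hsub Primrec.snd Primrec.fst) (PrimrecPred.and (hsub Primrec.fst Primrec.snd) ?_))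
  exact (PrimrecPred.and (primrec_isZero.comp (Primrec.fst.comp (hp.comp Primrec.snd)))
    (Primrec.eq.comp (Primrec.snd.comp (hp.comp Primrec.snd)) (const 0))).of_eq
      fun x => (prod_map_ofCode_eq_one_iff x.2).symm

theorem primrec_loops : Primrec loops := by
  have h1 : PrimrecPred fun c : List (ℤ × ℤ) × ℤ => c.2 = 1 := Primrec.eq.comp Primrec.snd (const 1)
  have h2 : PrimrecPred fun c : List (ℤ × ℤ) × ℤ => c.2 = -1 :=
    Primrec.eq.comp Primrec.snd (const (-1))
  exact list_flatMap (listFilter h1) (list_map ((listFilter h2).comp Primrec.fst)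
    (list_append.comp (Primrec.fst.comp (Primrec.snd.comp Primrec.fst))
      (primrec_shift.comp (const 1) (Primrec.fst.comp Primrec.snd))).to₂).to₂

theorem primrecPred_units :
    PrimrecPred fun L : List (List (ℤ × ℤ) × ℤ) => ∀ g ∈ generators L, g.snd = 1 ∨ g.snd = -1 :=
  (PrimrecPred.forall_mem_list (p := fun c : List (ℤ × ℤ) × ℤ => c.2 = 1 ∨ c.2 = -1)
    (PrimrecPred.or (Primrec.eq.comp Primrec.snd (const 1))
      (Primrec.eq.comp Primrec.snd (const (-1))))).of_eq fun _ =>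
      ⟨fun h _ ⟨c, hc, hcg⟩ => hcg ▸ h c hc, fun h c hc => h (ofCode c) ⟨c, hc, rfl⟩⟩

theorem not_exists_isFullRelator_iff {L : List (List (ℤ × ℤ) × ℤ)}
    (hL : ∀ g ∈ generators L, g.snd = 1 ∨ g.snd = -1) :
    (¬∃ w, IsFullRelator L w) ↔
      ∃ c : ObstructionCode, loops L = [] ∨ c.Obstructs (loops L) := by
  rw [exists_isFullRelator_iff fun c hc => hL (ofCode c) ⟨c, hc, rfl⟩]
  constructor
  · intro h
    by_cases h0 : loops L = []
    · exact ⟨([], [], [], (0, 0, 0), []), Or.inl h0⟩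
    · by_contra! hno
      exact h ⟨h0, fun c => (hno c).2⟩
  · rintro ⟨c, h | h⟩ ⟨h1, h2⟩
    exacts [h1 h, h2 c h]

theorem primrec_loops_obstructed : PrimrecRel fun (L : List (List (ℤ × ℤ) × ℤ))
    (c : ObstructionCode) => loops L = [] ∨ c.Obstructs (loops L) :=
  PrimrecPred.or (Primrec.eq.comp (primrec_loops.comp Primrec.fst) (const []))
    (ObstructionCode.primrec_obstructs.comp Primrec.snd (primrec_loops.comp Primrec.fst))

end ZWrZ

/-! ### The two decision problems -/

open ZWrZ in
theorem decidableProblem_group :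
    DecidableProblem
      (fun L : List (List (ℤ × ℤ) × ℤ) => ∀ g ∈ ZWrZ.generators L, g.snd = 1 ∨ g.snd = -1)
      (fun L => SemigroupIsGroup (Subsemigroup.closure (ZWrZ.generators L))) :=
  DecidableProblem.of_primrec primrecPred_units primrec_isFullRelator primrec_loops_obstructed
    (fun _ _ => semigroupIsGroup_iff)
    (fun _ hL => (not_congr semigroupIsGroup_iff).trans (not_exists_isFullRelator_iff hL))
    ([], [], [], (0, 0, 0), [])

open ZWrZ Primrec in
theorem decidableProblem_identity :
    DecidableProblem
      (fun L : List (List (ℤ × ℤ) × ℤ) => ∀ g ∈ ZWrZ.generators L, g.snd = 1 ∨ g.snd = -1)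
      (fun L => (1 : ZWrZ) ∈ Subsemigroup.closure (ZWrZ.generators L)) := by
  refine DecidableProblem.of_primrec
    (y := fun L w => ∃ M ∈ L.sublists', IsFullRelator M w)
    -- A negative answer must rule out every sublist, so its certificate is a finite list of
    -- obstructions.
    (n := fun L (cs : List ObstructionCode) => ∀ M ∈ L.sublists',
      ∃ c ∈ cs, loops M = [] ∨ c.Obstructs (loops M))
    primrecPred_units ?_ ?_ (fun L _ => ?_) (fun L hL => ?_) []
  · exact PrimrecPred.exists_mem_list_comp (list_sublists'.comp Primrec.fst)
      (primrec_isFullRelator.comp Primrec.snd (Primrec.snd.comp Primrec.fst))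
  · exact PrimrecPred.forall_mem_list_comp (list_sublists'.comp Primrec.fst)
      (PrimrecPred.exists_mem_list_comp (Primrec.snd.comp Primrec.fst)
        (primrec_loops_obstructed.comp (Primrec.snd.comp Primrec.fst) Primrec.snd))
  · rw [one_mem_closure_iff, exists_comm]
    simp only [exists_and_left]
  · rw [one_mem_closure_iff]
    have hM : ∀ M ∈ L.sublists', ∀ g ∈ generators M, g.snd = 1 ∨ g.snd = -1 :=
      fun M hM g ⟨c, hc, hcg⟩ => hL g ⟨c, (List.mem_sublists'.1 hM).subset hc, hcg⟩
    push Not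
    constructor
    · intro h
      have hc : ∀ M, ∃ c : ObstructionCode, M ∈ L.sublists' →
          (loops M = [] ∨ c.Obstructs (loops M)) := fun M => by
        by_cases hML : M ∈ L.sublists'
        · obtain ⟨c, hc⟩ := (not_exists_isFullRelator_iff (hM M hML)).1
            (not_exists.2 (h M hML))
          exact ⟨c, fun _ => hc⟩
        · exact ⟨([], [], [], (0, 0, 0), []), fun h => absurd h hML⟩
      choose c hc using hc
      exact ⟨L.sublists'.map c, fun M hML => ⟨c M, List.mem_map.2 ⟨M, hML, rfl⟩, hc M hML⟩⟩
    · rintro ⟨cs, hcs⟩ M hML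
      obtain ⟨c, -, hc⟩ := hcs M hML
      exact not_exists.1 ((not_exists_isFullRelator_iff (hM M hML)).2 ⟨c, hc⟩)

theorem theorem4 :
    -- Group Problem
    DecidableProblem
      (fun L : List (List (ℤ × ℤ) × ℤ) =>
        ∀ g ∈ ZWrZ.generators L, g.snd = 1 ∨ g.snd = -1)
      (fun L => SemigroupIsGroup (Subsemigroup.closure (ZWrZ.generators L))) ∧
    -- Identity Problem
    DecidableProblem
      (fun L : List (List (ℤ × ℤ) × ℤ) =>
        ∀ g ∈ ZWrZ.generators L, g.snd = 1 ∨ g.snd = -1)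
      (fun L => (1 : ZWrZ) ∈ Subsemigroup.closure (ZWrZ.generators L)) :=
  ⟨decidableProblem_group, decidableProblem_identity⟩
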